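/- **Setting.** For $n\in\mathbb N$, $p\in(0,1)$ and $\rho\in(0,1]$, let $\mathcal P_0=\mathcal P_0^{(n)}$ be the law of two independent Erdős–Rényi graphs $G_1,G_2\sim\mathcal G(n,p)$ on the vertex set $[n]$. Let $\mathcal P_1=\mathcal P_1^{(n)}$ be the law of the correlated pair $(G_1,G_2)\sim\mathcal G(n,p,\rho)$: a latent permutation $\pi$ of $[n]$ is drawn uniformly at random and, given $\pi$, the pairs $(\mathbf 1\{uv\in E(G_1)\},\mathbf 1\{\pi(u)\pi(v)\in E(G_2)\})$ are independent over the unordered pairs $u\ne v$, each being bivariate Bernoulli with both marginals Bernoulli$(p)$ and correlation coefficient $\rho$. A motif $\mathsf M$ is a finite simple graph with $\mathsf v(\mathsf M)$ vertices and $\mathsf e(\mathsf M)$ edges; a motif family $\mathcal M$ is a finite set of pairwise non-isomorphic motifs. With $\beta_{uv}(\bar G)=\mathbf 1\{uv\in E(G)\}-p$, put $$\mathsf{inj}(\mathsf M,\bar G)=\sum_{\varphi:V(\mathsf M)\to[n]\ \text{injective}}\ \prod_{uv\in E(\mathsf M)}\beta_{\varphi(u)\varphi(v)}(\bar G),\qquad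 \mathcal T_{\mathcal M}(G_1,G_2)=\sum_{\mathsf M\in\mathcal M}\omega_{\mathsf M}\,\mathsf{inj}(\mathsf M,\bar G_1)\,\mathsf{inj}(\mathsf M,\bar G_2),$$ where $\omega_{\mathsf M}\in\mathbb R$ are weights. Let $p=p_n$, $\rho=\rho_n\in(0,1]$, $C=C_n\in\mathbb R$ and $\mathcal M=\mathcal M_n$ depend on $n$, with $0<p_n\le 1-\delta$ for all $n$ and some constant $\delta>0$. The motif family $\mathcal M$ is called $C$-admissible if $C=o\!\left(\frac{\log n}{\max(\log\log n,\,-\log\rho)}\right)$ as $n\to\infty$ and there is a constant $\epsilon_0>0$, independent of $n$, such that for all sufficiently large $n$: 1. every $\mathsf M\in\mathcal M$ is connected; 2. $\max(\mathsf v(\mathsf M),\mathsf e(\mathsf M))\le C$ for every $\mathsf M\in\mathcal M$; 3. $\sum_{\mathsf M\in\mathcal M}\rho^{2\mathsf e(\mathsf M)}\ge 400$; 4. $n^{\mathsf v(\mathsf M')}p^{\mathsf e(\mathsf M')}\ge n^{\epsilon_0}$ for every $\mathsf M\in\mathcal M$ and every subgraph $\mathsf M'\subseteq\mathsf M$ with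 at least one vertex. **Theorem.** If $\mathcal M$ is $C$-admissible, then for all sufficiently large $n$ there exist weights $\omega_{\mathsf M}\in\mathbb R$ $(\mathsf M\in\mathcal M)$ and a threshold $\tau\in\mathbb R$ such that $$\mathcal P_0(\mathcal T_{\mathcal M}\ge\tau)+\mathcal P_1(\mathcal T_{\mathcal M}<\tau)\le 0.05 .$$ -/

import Mathlib

open MeasureTheory Filter unitInterval
open scoped ENNReal

namespace MotifTest

/-! ### The two hypotheses -/

/-- The law of `(G₁, G₂)` under the null hypothesis: two independent Erdős–Rényi graphs
`𝒢(n, p)` on the vertex set `Fin n`. -/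
noncomputable def nullLaw (n : ℕ) (p : I) : Measure (SimpleGraph (Fin n) × SimpleGraph (Fin n)) :=
  (SimpleGraph.binomialRandom (Fin n) p).prod (SimpleGraph.binomialRandom (Fin n) p)

/-- The bivariate Bernoulli law with both marginals Bernoulli(`p`) and correlation
coefficient `ρ`. -/
noncomputable def correlatedBernoulli (p ρ : I) : Measure (Bool × Bool) :=
  ENNReal.ofReal ((p : ℝ) ^ 2 + ρ * (p * (1 - p))) • Measure.dirac (true, true)
    + ENNReal.ofReal ((1 - ρ) * (p * (1 - p))) • Measure.dirac (true, false)
    + ENNReal.ofReal ((1 - ρ) * (p * (1 - p))) • Measure.dirac (false, true)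
    + ENNReal.ofReal ((1 - (p : ℝ)) ^ 2 + ρ * (p * (1 - p))) • Measure.dirac (false, false)

/-- The pair of graphs built from one pair of bits `x e` for each unordered pair of vertices `e`:
`e` is an edge of the first graph iff the first bit is set, and `π(e)` is an edge of the second
graph iff the second bit is set. (`SimpleGraph.fromEdgeSet` discards the loops `s(u, u)`.) -/
def graphPair {n : ℕ} (π : Equiv.Perm (Fin n)) (x : Sym2 (Fin n) → Bool × Bool) :
    SimpleGraph (Fin n) × SimpleGraph (Fin n) :=
  (SimpleGraph.fromEdgeSet {e | (x e).1 = true},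
    (SimpleGraph.fromEdgeSet {e | (x e).2 = true}).map π)

/-- The law of `(G₁, G₂)` under the alternative conditionally on the latent bijection `π`: the
pairs of indicators of `(uv, π(u)π(v))` are independent over the unordered pairs `uv`, each one
correlated bivariate Bernoulli. -/
noncomputable def altLawGiven {n : ℕ} (p ρ : I) (π : Equiv.Perm (Fin n)) :
    Measure (SimpleGraph (Fin n) × SimpleGraph (Fin n)) :=
  (Measure.pi fun _ : Sym2 (Fin n) => correlatedBernoulli p ρ).map (graphPair π)

/-- The law of `(G₁, G₂)` under the alternative hypothesis: the correlated Erdős–Rényi graph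
`𝒢(n, p, ρ)`, with a uniformly random latent bijection. -/
noncomputable def altLaw (n : ℕ) (p ρ : I) :
    Measure (SimpleGraph (Fin n) × SimpleGraph (Fin n)) :=
  (Fintype.card (Equiv.Perm (Fin n)) : ℝ≥0∞)⁻¹ • ∑ π : Equiv.Perm (Fin n), altLawGiven p ρ π

/-! ### Motifs and the test statistic -/

/-- A motif: a finite simple graph, on the vertex set `Fin v`. -/
structure Motif where
  /-- the number of vertices -/
  v : ℕ
  /-- the graph -/
  graph : SimpleGraph (Fin v)

/-- The number of edges of a motif. -/
noncomputable def Motif.e (M : Motif) : ℕ := M.graph.edgeSet.ncard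

/-- A motif family is a finite set of motifs up to isomorphism: no two distinct members are
isomorphic. -/
def IsMotifFamily (F : Finset Motif) : Prop :=
  ∀ M ∈ F, ∀ N ∈ F, Nonempty (M.graph ≃g N.graph) → M = N

open Classical in
/-- The centered weights `β_{uv}(Ḡ) = 1{uv ∈ E(G)} - p` of a graph. -/
noncomputable def centered {n : ℕ} (p : I) (G : SimpleGraph (Fin n)) (e : Sym2 (Fin n)) : ℝ :=
  (if e ∈ G.edgeSet then 1 else 0) - p

open Classical in
/-- `inj(M, G)` for a weighted graph `G` with edge weights `β`: the sum over all injective maps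
`φ` of the vertices of `M` of the product of `β_{φ(u)φ(v)}` over the edges `uv` of `M`. -/
noncomputable def injCount {n : ℕ} (M : Motif) (β : Sym2 (Fin n) → ℝ) : ℝ :=
  ∑ φ : Fin M.v ↪ Fin n, ∏ e ∈ M.graph.edgeFinset, β (e.map φ)

/-- The motif counting statistic `𝒯(G₁, G₂) = ∑_M ω_M inj(M, Ḡ₁) inj(M, Ḡ₂)`. -/
noncomputable def statistic {n : ℕ} (p : I) (F : Finset Motif) (ω : Motif → ℝ)
    (G : SimpleGraph (Fin n) × SimpleGraph (Fin n)) : ℝ :=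
  ∑ M ∈ F, ω M * injCount M (centered p G.1) * injCount M (centered p G.2)

/-! ### Admissibility -/

/-- The conditions of admissibility at a given `n`, with size bound `C` and exponent `ε₀`. -/
structure IsAdmissibleAt (n : ℕ) (p ρ : I) (C ε₀ : ℝ) (F : Finset Motif) : Prop where
  connected : ∀ M ∈ F, M.graph.Connected
  size_le : ∀ M ∈ F, (M.v : ℝ) ≤ C ∧ (M.e : ℝ) ≤ C
  signal : 400 ≤ ∑ M ∈ F, (ρ : ℝ) ^ (2 * M.e)
  subgraph : ∀ M ∈ F, ∀ M' : M.graph.Subgraph, M'.verts.Nonempty →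
    (n : ℝ) ^ ε₀ ≤ (n : ℝ) ^ M'.verts.ncard * (p : ℝ) ^ M'.edgeSet.ncard

/-- `C`-admissibility of a sequence of motif families `F n`, for parameters `p n`, `ρ n` and size
bounds `C n`: `C = o(log n / max(log log n, -log ρ))`, and the other conditions hold for all large
`n` with a constant `ε₀ > 0` that does not depend on `n`. -/
def IsAdmissible (p ρ : ℕ → I) (C : ℕ → ℝ) (F : ℕ → Finset Motif) : Prop :=
  C =o[atTop] (fun n : ℕ =>
      Real.log n / max (Real.log (Real.log n)) (-Real.log (ρ n))) ∧
    ∃ ε₀ : ℝ, 0 < ε₀ ∧ ∀ᶠ n in atTop, IsAdmissibleAt n (p n) (ρ n) (C n) ε₀ (F n)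

end MotifTest

/-!
Weight each motif by `ω_M = ρ^{e(M)} / Var(inj(M, Ḡ))`. Then the statistic has variance
`S = ∑_M ρ^{2e(M)}` under the null hypothesis and mean `S` under the alternative, so thresholding at
`S / 2` works by Chebyshev's inequality once its second moment under the alternative is at most
`(1 + o(1)) S² + 2S`. Since a relabelling of the second graph does not change the statistic, the
latent permutation can be taken to be the identity.

The second moment expands over quadruples of copies `A, C` of `M` and `B, D` of `N`, where `A, B`
lie in the first graph and `C, D` in the second one. A quadruple contributes only if every edge it
uses is used at least twice. If no vertex is used more than twice, connectedness forces the copies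
to coincide in pairs: the quadruples with `A = C`, `B = D` produce `S²`, those with `A = B`, `C = D`
or `A = D`, `B = C` force `M = N` and produce `2S`. Otherwise one of the graphs `A ∩ B ∩ (C ∪ D)`
and `C ∩ D ∩ (A ∪ B)` is nonempty. These are subgraphs of `A` and of `C`, and together they count
the uses of vertices and edges in excess of two, so the density condition on them saves a power of
`n`. It beats the loss of at most `K^{O(K)} ρ^{-2K}` from the number of overlap patterns and the
weights, because the motifs have size at most `K = o(log n / max(log log n, -log ρ))`.
-/

namespace MotifTest

section DoubleCover

variable {α : Type*} [DecidableEq α]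

/-- The number of the sets `A`, `B` that contain `x`. -/
def mult (A B : Finset α) (x : α) : ℕ := (if x ∈ A then 1 else 0) + (if x ∈ B then 1 else 0)

/-- Four sets form a double cover if each point of their union lies in at least two of them. -/
def IsDoubleCover (A B C D : Finset α) : Prop := ∀ x, mult A B x + mult C D x ≠ 1

/-- The points of `A ∩ B` that lie in a third set. Of four sets, `tripleInter A B C D` and
`tripleInter C D A B` together count the multiplicities in excess of two. -/
def tripleInter (A B C D : Finset α) : Finset α := A ∩ B ∩ (C ∪ D)

variable {A B C D : Finset α}

lemma mult_le_two (A B : Finset α) (x : α) : mult A B x ≤ 2 := by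
  unfold mult; split_ifs <;> omega

lemma IsDoubleCover.swap_right (h : IsDoubleCover A B C D) : IsDoubleCover A B D C := fun x => by
  have := h x; simp only [mult] at this ⊢; omega

lemma IsDoubleCover.swap_middle (h : IsDoubleCover A B C D) : IsDoubleCover A C B D := fun x => by
  have := h x; simp only [mult] at this ⊢; omega

lemma IsDoubleCover.swap_pairs (h : IsDoubleCover A B C D) : IsDoubleCover C D A B := fun x => by
  rw [add_comm]; exact h x

lemma isDoubleCover_iff : IsDoubleCover A B C D ↔
    A ⊆ B ∪ (C ∪ D) ∧ B ⊆ A ∪ (C ∪ D) ∧ C ⊆ D ∪ (A ∪ B) ∧ D ⊆ C ∪ (A ∪ B) := by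
  simp only [IsDoubleCover, mult, Finset.subset_iff, Finset.mem_union, ← forall_and]
  refine forall_congr' fun x => ?_
  split_ifs <;> simp_all

lemma IsDoubleCover.card_add_card (h : IsDoubleCover A B C D) :
    A.card + B.card + C.card + D.card = 2 * (A ∪ B ∪ (C ∪ D)).card
      + (tripleInter A B C D).card + (tripleInter C D A B).card := by
  have card_eq_sum {S : Finset α} (hS : S ⊆ A ∪ B ∪ (C ∪ D)) :
      S.card = ∑ x ∈ A ∪ B ∪ (C ∪ D), if x ∈ S then 1 else 0 := by
    rw [← Finset.sum_filter, ← Finset.card_eq_sum_ones, Finset.filter_mem_eq_inter,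
      Finset.inter_eq_right.2 hS]
  rw [card_eq_sum (S := A) (by grind), card_eq_sum (S := B) (by grind),
    card_eq_sum (S := C) (by grind), card_eq_sum (S := D) (by grind),
    card_eq_sum (S := tripleInter A B C D) (by grind [tripleInter]),
    card_eq_sum (S := tripleInter C D A B) (by grind [tripleInter]), Finset.card_eq_sum_ones]
  simp only [Finset.mul_sum, ← Finset.sum_add_distrib]
  refine Finset.sum_congr rfl fun x hx => ?_
  have hx' := h x
  simp only [mult, tripleInter] at hx' ⊢
  by_cases hA : x ∈ A <;> by_cases hB : x ∈ B <;> by_cases hC : x ∈ C <;> by_cases hD : x ∈ D <;>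
    simp_all

end DoubleCover

section EdgeSets

variable {V : Type*} [DecidableEq V]

/-- The vertices covered by a set of edges. -/
def verts (E : Finset (Sym2 V)) : Finset V := E.biUnion Sym2.toFinset

/-- A nonempty set of edges is connected if it cannot be split into two nonempty parts without
common vertices. -/
def IsEdgeConnected (A : Finset (Sym2 V)) : Prop :=
  A.Nonempty ∧ ∀ B ⊆ A, B.Nonempty → Disjoint (verts B) (verts (A \ B)) → B = A

/-- Some vertex is covered by at least three of the four sets of edges. -/
def HasTriple (A B C D : Finset (Sym2 V)) : Prop :=
  ∃ w, 3 ≤ mult (verts A) (verts B) w + mult (verts C) (verts D) w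

/-- A set of edges `A` is `r`-dense, at scale `N` and edge density `q`, if each of its nonempty
subgraphs `(S, E)` has at least `r` expected copies `N ^ |S| * q ^ |E|`. -/
def IsDense (r N q : ℝ) (A : Finset (Sym2 V)) : Prop :=
  ∀ S ⊆ verts A, ∀ E ⊆ A, verts E ⊆ S → S.Nonempty → r ≤ N ^ S.card * q ^ E.card

variable {A B C D E : Finset (Sym2 V)}

@[simp]
lemma mem_verts {w : V} : w ∈ verts E ↔ ∃ e ∈ E, w ∈ e := by simp [verts]

lemma verts_mono (h : A ⊆ B) : verts A ⊆ verts B := Finset.biUnion_subset_biUnion_of_subset_left _ h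

lemma verts_union : verts (A ∪ B) = verts A ∪ verts B := Finset.union_biUnion

lemma verts_eq_empty_iff : verts E = ∅ ↔ E = ∅ := by
  refine ⟨fun h => Finset.eq_empty_of_forall_notMem fun e he => ?_, by rintro rfl; rfl⟩
  have : e.out.1 ∈ verts E := mem_verts.2 ⟨e, he, e.out_fst_mem⟩
  simp [h] at this

lemma disjoint_of_disjoint_verts (h : Disjoint (verts A) (verts B)) : Disjoint A B := by
  rw [Finset.disjoint_left] at h ⊢
  exact fun e hA hB =>
    h (mem_verts.2 ⟨e, hA, e.out_fst_mem⟩) (mem_verts.2 ⟨e, hB, e.out_fst_mem⟩)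

lemma verts_tripleInter_subset :
    verts (tripleInter A B C D) ⊆ tripleInter (verts A) (verts B) (verts C) (verts D) := by
  intro w
  simp only [tripleInter, mem_verts, Finset.mem_inter, Finset.mem_union]
  grind

lemma IsDoubleCover.on_verts (h : IsDoubleCover A B C D) :
    IsDoubleCover (verts A) (verts B) (verts C) (verts D) := by
  rw [isDoubleCover_iff] at h ⊢
  simp only [← verts_union]
  exact ⟨verts_mono h.1, verts_mono h.2.1, verts_mono h.2.2.1, verts_mono h.2.2.2⟩

lemma HasTriple.swap_right (h : HasTriple A B C D) : HasTriple A B D C :=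
  h.imp fun w hw => by simp only [mult] at hw ⊢; omega

lemma HasTriple.swap_middle (h : HasTriple A B C D) : HasTriple A C B D :=
  h.imp fun w hw => by simp only [mult] at hw ⊢; omega

lemma HasTriple.swap_pairs (h : HasTriple A B C D) : HasTriple C D A B :=
  h.imp fun w hw => by rwa [add_comm]

lemma hasTriple_iff : HasTriple A B C D ↔
    (tripleInter (verts A) (verts B) (verts C) (verts D)).Nonempty ∨
      (tripleInter (verts C) (verts D) (verts A) (verts B)).Nonempty := by
  simp only [HasTriple, Finset.Nonempty, ← exists_or]
  refine exists_congr fun w => ?_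
  simp only [mult, tripleInter, Finset.mem_inter, Finset.mem_union]
  split_ifs <;> simp_all

lemma disjoint_of_not_hasTriple (h : ¬ HasTriple A B C D) :
    Disjoint (verts A ∩ verts B) (verts (C ∪ D)) := by
  rw [hasTriple_iff, not_or, Finset.not_nonempty_iff_eq_empty] at h
  rw [verts_union, Finset.disjoint_iff_inter_eq_empty]
  exact h.1

lemma IsEdgeConnected.subset_of_subset_union (hA : IsEdgeConnected A) (hAE : A ⊆ B ∪ E)
    (hdisj : Disjoint (verts A ∩ verts B) (verts E)) (hmeet : (A ∩ B).Nonempty) : A ⊆ B := by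
  rw [← Finset.inter_eq_left]
  refine hA.2 _ Finset.inter_subset_left hmeet (hdisj.mono ?_ (verts_mono ?_))
  · exact Finset.subset_inter (verts_mono Finset.inter_subset_left)
      (verts_mono Finset.inter_subset_right)
  · grind

lemma IsDoubleCover.eq_of_inter_nonempty (hA : IsEdgeConnected A) (hB : IsEdgeConnected B)
    (hcover : IsDoubleCover A B C D) (htriple : ¬ HasTriple A B C D) (hmeet : (A ∩ B).Nonempty) :
    A = B := by
  have hdisj := disjoint_of_not_hasTriple htriple
  obtain ⟨hAcov, hBcov, -⟩ := isDoubleCover_iff.1 hcover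
  refine (hA.subset_of_subset_union hAcov hdisj hmeet).antisymm
    (hB.subset_of_subset_union hBcov ?_ ?_)
  · rwa [Finset.inter_comm]
  · rwa [Finset.inter_comm]

lemma eq_and_eq_of_inter_nonempty (hA : IsEdgeConnected A) (hB : IsEdgeConnected B)
    (hC : IsEdgeConnected C) (hD : IsEdgeConnected D) (hcover : IsDoubleCover A B C D)
    (htriple : ¬ HasTriple A B C D) (hmeet : (A ∩ B).Nonempty) :
    A = B ∧ C = D ∧ Disjoint A C := by
  obtain rfl := IsDoubleCover.eq_of_inter_nonempty hA hB hcover htriple hmeet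
  have hdisj : Disjoint A (C ∪ D) := by
    have hverts := disjoint_of_not_hasTriple htriple
    rw [Finset.inter_self] at hverts
    exact disjoint_of_disjoint_verts hverts
  have hCD : C ⊆ D := by
    have := (isDoubleCover_iff.1 hcover).2.2.1
    grind [Finset.disjoint_left]
  refine ⟨rfl, ?_, hdisj.mono_right Finset.subset_union_left⟩
  refine IsDoubleCover.eq_of_inter_nonempty hC hD hcover.swap_pairs
    (fun h => htriple h.swap_pairs) ?_
  rw [Finset.inter_eq_left.2 hCD]
  exact hC.1

lemma IsDoubleCover.pairing (hcover : IsDoubleCover A B C D) (hA : IsEdgeConnected A)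
    (hB : IsEdgeConnected B) (hC : IsEdgeConnected C) (hD : IsEdgeConnected D)
    (htriple : ¬ HasTriple A B C D) :
    (A = B ∧ C = D ∧ Disjoint A C) ∨ (A = C ∧ B = D ∧ Disjoint A B) ∨
      (A = D ∧ B = C ∧ Disjoint A B) := by
  obtain ⟨e, he⟩ := hA.1
  have he' := (isDoubleCover_iff.1 hcover).1 he
  simp only [Finset.mem_union] at he'
  rcases he' with h | h | h
  · exact .inl (eq_and_eq_of_inter_nonempty hA hB hC hD hcover htriple
      ⟨e, Finset.mem_inter.2 ⟨he, h⟩⟩)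
  · exact .inr (.inl (eq_and_eq_of_inter_nonempty hA hC hB hD hcover.swap_middle
      (fun h => htriple h.swap_middle) ⟨e, Finset.mem_inter.2 ⟨he, h⟩⟩))
  · obtain ⟨rfl, rfl, h'⟩ := eq_and_eq_of_inter_nonempty hA hD hB hC
      hcover.swap_right.swap_middle (fun h => htriple h.swap_middle.swap_right)
      ⟨e, Finset.mem_inter.2 ⟨he, h⟩⟩
    exact .inr (.inr ⟨rfl, rfl, h'⟩)

section Density

variable {r N q δ : ℝ} {K : ℕ}

lemma IsDense.of_mul_le {r' q' : ℝ} (h : IsDense r N q A) (hN : 0 ≤ N) (hq : 0 ≤ q) (hδ₀ : 0 ≤ δ)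
    (hδ₁ : δ ≤ 1) (hK : A.card ≤ K) (hq' : q * δ ≤ q') (hr : r' ≤ r * δ ^ K) :
    IsDense r' N q' A := by
  intro S hS E hE hES hne
  calc r' ≤ r * δ ^ K := hr
    _ ≤ N ^ S.card * q ^ E.card * δ ^ E.card := by
        have hpow : δ ^ K ≤ δ ^ E.card :=
          pow_le_pow_of_le_one hδ₀ hδ₁ ((Finset.card_le_card hE).trans hK)
        exact mul_le_mul (h S hS E hE hES hne) hpow (by positivity) (by positivity)
    _ = N ^ S.card * (q * δ) ^ E.card := by rw [mul_pow, mul_assoc]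
    _ ≤ N ^ S.card * q' ^ E.card := by gcongr

lemma IsDense.le_tripleInter (h : IsDense r N q A)
    (hne : (tripleInter (verts A) (verts B) (verts C) (verts D)).Nonempty) :
    r ≤ N ^ (tripleInter (verts A) (verts B) (verts C) (verts D)).card
      * q ^ (tripleInter A B C D).card :=
  h _ (Finset.inter_subset_left.trans Finset.inter_subset_left) _
    (Finset.inter_subset_left.trans Finset.inter_subset_left) verts_tripleInter_subset hne

lemma IsDense.one_le_tripleInter (h : IsDense r N q A) (hr : 1 ≤ r) :
    1 ≤ N ^ (tripleInter (verts A) (verts B) (verts C) (verts D)).card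
      * q ^ (tripleInter A B C D).card := by
  rcases Finset.eq_empty_or_nonempty (tripleInter (verts A) (verts B) (verts C) (verts D))
    with hempty | hne
  · have : tripleInter A B C D = ∅ :=
      verts_eq_empty_iff.1 (Finset.subset_empty.1 (hempty ▸ verts_tripleInter_subset))
    simp [hempty, this]
  · exact hr.trans (h.le_tripleInter hne)

lemma IsDense.le_tripleInter_mul (hA : IsDense r N q A) (hC : IsDense r N q C) (hr : 1 ≤ r)
    (h : HasTriple A B C D) :
    r ≤ N ^ (tripleInter (verts A) (verts B) (verts C) (verts D)).card
        * q ^ (tripleInter A B C D).card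
      * (N ^ (tripleInter (verts C) (verts D) (verts A) (verts B)).card
        * q ^ (tripleInter C D A B).card) := by
  have hr₀ := zero_le_one.trans hr
  rcases hasTriple_iff.1 h with hAB | hCD
  · simpa using mul_le_mul (hA.le_tripleInter hAB)
      (hC.one_le_tripleInter hr) zero_le_one (hr₀.trans (hA.le_tripleInter hAB))
  · simpa using mul_le_mul (hA.one_le_tripleInter hr)
      (hC.le_tripleInter hCD) hr₀ (zero_le_one.trans (hA.one_le_tripleInter hr))

lemma IsDoubleCover.sq_mul_le (hcover : IsDoubleCover A B C D) (htriple : HasTriple A B C D)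
    (hA : IsDense (r ^ 2) N q A) (hC : IsDense (r ^ 2) N q C) (hr : 1 ≤ r) :
    (q ^ (A ∪ B ∪ (C ∪ D)).card * N ^ (verts (A ∪ B ∪ (C ∪ D))).card * r) ^ 2
      ≤ q ^ (A.card + B.card + C.card + D.card)
        * N ^ ((verts A).card + (verts B).card + (verts C).card + (verts D).card) := by
  rw [hcover.card_add_card, hcover.on_verts.card_add_card]
  simp only [verts_union]
  calc _ = (q ^ (A ∪ B ∪ (C ∪ D)).card
          * N ^ (verts A ∪ verts B ∪ (verts C ∪ verts D)).card) ^ 2 * r ^ 2 := mul_pow ..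
    _ ≤ _ := mul_le_mul_of_nonneg_left (hA.le_tripleInter_mul hC (one_le_pow₀ hr) htriple)
        (sq_nonneg _)
    _ = _ := by ring

lemma IsDoubleCover.pow_card_le (hcover : IsDoubleCover A B C D)
    (htriple : HasTriple A B C D) (hA : IsDense (r ^ 2) N q A) (hC : IsDense (r ^ 2) N q C)
    (hAC : A.card = C.card) (hBD : B.card = D.card) (hAC' : (verts A).card = (verts C).card)
    (hBD' : (verts B).card = (verts D).card) (hr : 1 ≤ r) (hN : 0 < N) (hq : 0 ≤ q) :
    q ^ (A ∪ B ∪ (C ∪ D)).card ≤ q ^ (A.card + B.card) * N ^ ((verts A).card + (verts B).card) / r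
      * (N ^ (verts (A ∪ B ∪ (C ∪ D))).card)⁻¹ := by
  have hsq := hcover.sq_mul_le htriple hA hC hr
  rw [← hAC, ← hBD, ← hAC', ← hBD', add_assoc (A.card + _), add_assoc ((verts A).card + _),
    ← two_mul, ← two_mul, mul_comm 2, mul_comm 2, pow_mul, pow_mul, ← mul_pow] at hsq
  rw [← div_eq_mul_inv, div_div, le_div_iff₀ (by positivity), mul_comm r, ← mul_assoc]
  exact (sq_le_sq₀ (by positivity) (by positivity)).1 hsq

end Density

end EdgeSets

section ImageSize

variable {V : Type*} [Fintype V] [Nonempty V] [DecidableEq V]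

lemma sum_inv_card_pow_card_insert_le (S : Finset V) :
    ∑ x, ((Fintype.card V : ℝ) ^ (insert x S).card)⁻¹
      ≤ (S.card + 1) * ((Fintype.card V : ℝ) ^ S.card)⁻¹ := by
  have hV : (0 : ℝ) < Fintype.card V := by exact_mod_cast Fintype.card_pos
  have hterm (x : V) : ((Fintype.card V : ℝ) ^ (insert x S).card)⁻¹
      ≤ ((if x ∈ S then 1 else 0) + (Fintype.card V : ℝ)⁻¹)
        * ((Fintype.card V : ℝ) ^ S.card)⁻¹ := by
    by_cases hx : x ∈ S
    · rw [Finset.insert_eq_of_mem hx, if_pos hx]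
      exact le_mul_of_one_le_left (by positivity) (by simp)
    · rw [Finset.card_insert_of_notMem hx, if_neg hx, zero_add, pow_succ', mul_inv]
  refine (Finset.sum_le_sum fun x _ => hterm x).trans_eq ?_
  rw [← Finset.sum_mul, Finset.sum_add_distrib]
  simp [hV.ne']

lemma sum_inv_card_pow_card_image_fin_le (k : ℕ) :
    ∑ g : Fin k → V, ((Fintype.card V : ℝ) ^ (Finset.univ.image g).card)⁻¹ ≤ k.factorial := by
  induction k with
  | zero => simp
  | succ k ih =>
    have himage (x : V) (g : Fin k → V) : Finset.univ.image (Fin.cons x g : Fin (k + 1) → V)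
        = insert x (Finset.univ.image g) := by
      ext w; simp [Fin.exists_fin_succ, eq_comm]
    calc ∑ g : Fin (k + 1) → V, ((Fintype.card V : ℝ) ^ (Finset.univ.image g).card)⁻¹
        = ∑ g : Fin k → V, ∑ x,
            ((Fintype.card V : ℝ) ^ (insert x (Finset.univ.image g)).card)⁻¹ := by
          rw [← (Fin.consEquiv fun _ => V).sum_comp, Fintype.sum_prod_type_right]
          simp only [← himage]
          rfl
      _ ≤ ∑ g : Fin k → V,
            (k + 1) * ((Fintype.card V : ℝ) ^ (Finset.univ.image g).card)⁻¹ := by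
          refine Finset.sum_le_sum fun g _ => (sum_inv_card_pow_card_insert_le _).trans ?_
          gcongr
          simpa using Finset.card_image_le (s := Finset.univ) (f := g)
      _ ≤ (k + 1).factorial := by
          rw [← Finset.mul_sum, Nat.factorial_succ]
          push_cast
          gcongr

lemma sum_inv_card_pow_card_image_le {ι : Type*} [Fintype ι] [DecidableEq ι] :
    ∑ g : ι → V, ((Fintype.card V : ℝ) ^ (Finset.univ.image g).card)⁻¹
      ≤ (Fintype.card ι).factorial := by
  rw [← ((Fintype.equivFin ι).symm.arrowCongr (Equiv.refl V)).sum_comp]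
  convert! sum_inv_card_pow_card_image_fin_le (V := V) (Fintype.card ι) using 5 with g
  ext w
  simp [(Fintype.equivFin ι).surjective.exists]

end ImageSize

section Copies

variable {V : Type*} {M N : Motif} {φ : Fin M.v ↪ V}

open Classical in
/-- The edge set of the copy `φ(M)` of a motif. -/
noncomputable def edgeImage (M : Motif) (φ : Fin M.v ↪ V) : Finset (Sym2 V) :=
  M.graph.edgeFinset.map φ.sym2Map

lemma card_edgeImage (M : Motif) (φ : Fin M.v ↪ V) : (edgeImage M φ).card = M.e := by
  classical
  rw [edgeImage, Finset.card_map, Motif.e, ← SimpleGraph.coe_edgeFinset, Set.ncard_coe_finset]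

lemma mk_mem_edgeImage {a b : Fin M.v} : s(φ a, φ b) ∈ edgeImage M φ ↔ M.graph.Adj a b := by
  classical
  rw [edgeImage, ← SimpleGraph.mem_edgeSet, ← SimpleGraph.mem_edgeFinset]
  exact Finset.mem_map' φ.sym2Map (a := s(a, b))

lemma mem_edgeImage {e : Sym2 V} :
    e ∈ edgeImage M φ ↔ ∃ a b, M.graph.Adj a b ∧ e = s(φ a, φ b) := by
  classical
  simp only [edgeImage, Finset.mem_map, SimpleGraph.mem_edgeFinset, Sym2.exists,
    SimpleGraph.mem_edgeSet, Function.Embedding.sym2Map_apply, Sym2.map_mk]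
  grind

lemma not_isDiag_of_mem_edgeImage {e : Sym2 V} (he : e ∈ edgeImage M φ) : ¬ e.IsDiag := by
  obtain ⟨a, b, hab, rfl⟩ := mem_edgeImage.1 he
  simpa using hab.ne

lemma Motif.e_eq_zero_iff : M.e = 0 ↔ M.graph = ⊥ := by
  rw [Motif.e, Set.ncard_eq_zero, SimpleGraph.edgeSet_eq_empty]

lemma exists_adj_of_connected (hM : M.graph.Connected) (he : 1 ≤ M.e) (a : Fin M.v) :
    ∃ b, M.graph.Adj a b := by
  have hbot : M.graph ≠ ⊥ := mt Motif.e_eq_zero_iff.2 (by omega)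
  obtain ⟨c, d, hcd⟩ := SimpleGraph.ne_bot_iff_exists_adj.1 hbot
  have : Nontrivial (Fin M.v) := ⟨c, d, hcd.ne⟩
  exact hM.preconnected.exists_adj_of_nontrivial a

section Vertices

variable [DecidableEq V]

lemma verts_edgeImage (hM : M.graph.Connected) (he : 1 ≤ M.e) (φ : Fin M.v ↪ V) :
    verts (edgeImage M φ) = Finset.univ.map φ := by
  ext w
  simp only [mem_verts, Finset.mem_map, Finset.mem_univ, true_and]
  constructor
  · rintro ⟨_, h, hw⟩
    obtain ⟨a, b, -, rfl⟩ := mem_edgeImage.1 h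
    rcases Sym2.mem_iff.1 hw with rfl | rfl
    exacts [⟨a, rfl⟩, ⟨b, rfl⟩]
  · rintro ⟨a, rfl⟩
    obtain ⟨b, hb⟩ := exists_adj_of_connected hM he a
    exact ⟨s(φ a, φ b), mk_mem_edgeImage.2 hb, Sym2.mem_mk_left _ _⟩

lemma card_verts_edgeImage (hM : M.graph.Connected) (he : 1 ≤ M.e) (φ : Fin M.v ↪ V) :
    (verts (edgeImage M φ)).card = M.v := by
  rw [verts_edgeImage hM he, Finset.card_map, Finset.card_univ, Fintype.card_fin]

lemma isEdgeConnected_edgeImage (hM : M.graph.Connected) (he : 1 ≤ M.e) (φ : Fin M.v ↪ V) :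
    IsEdgeConnected (edgeImage M φ) := by
  refine ⟨Finset.card_pos.1 (by rwa [card_edgeImage]), fun B hB ⟨e₀, he₀⟩ hdisj => ?_⟩
  have mem_of_adj {a b : Fin M.v} (hab : M.graph.Adj a b) (ha : φ a ∈ verts B) :
      s(φ a, φ b) ∈ B := by
    by_contra hnot
    exact Finset.disjoint_left.1 hdisj ha (mem_verts.2
      ⟨_, Finset.mem_sdiff.2 ⟨mk_mem_edgeImage.2 hab, hnot⟩, Sym2.mem_mk_left _ _⟩)
  obtain ⟨a₀, b₀, -, rfl⟩ := mem_edgeImage.1 (hB he₀)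
  have hverts (a : Fin M.v) : φ a ∈ verts B := by
    by_contra ha
    obtain ⟨walk⟩ := hM.preconnected a₀ a
    obtain ⟨d, -, hfst, hsnd⟩ := walk.exists_boundary_dart {a | φ a ∈ verts B}
      (mem_verts.2 ⟨_, he₀, Sym2.mem_mk_left _ _⟩) ha
    exact hsnd (mem_verts.2 ⟨_, mem_of_adj d.adj hfst, Sym2.mem_mk_right _ _⟩)
  refine hB.antisymm fun e he => ?_
  obtain ⟨a, b, hab, rfl⟩ := mem_edgeImage.1 he
  exact mem_of_adj hab (hverts a)

lemma isDense_edgeImage {N q r : ℝ} (hM : M.graph.Connected) (he : 1 ≤ M.e)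
    (hsub : ∀ M' : M.graph.Subgraph, M'.verts.Nonempty →
      r ≤ N ^ M'.verts.ncard * q ^ M'.edgeSet.ncard) (φ : Fin M.v ↪ V) :
    IsDense r N q (edgeImage M φ) := by
  intro S hS E hE hES hne
  rw [verts_edgeImage hM he] at hS
  let M' : M.graph.Subgraph :=
    { verts := φ ⁻¹' S
      Adj := fun a b => s(φ a, φ b) ∈ E
      adj_sub := fun h => mk_mem_edgeImage.1 (hE h)
      edge_vert := fun h => hES (mem_verts.2 ⟨_, h, Sym2.mem_mk_left _ _⟩)
      symm := ⟨fun a b h => by rwa [Sym2.eq_swap]⟩ }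
  have hSrange : (S : Set V) ⊆ Set.range φ := by
    intro w hw
    obtain ⟨a, -, rfl⟩ := Finset.mem_map.1 (hS hw)
    exact ⟨a, rfl⟩
  have hErange : (E : Set (Sym2 V)) ⊆ Set.range φ.sym2Map := by
    intro e he
    obtain ⟨a, b, -, rfl⟩ := mem_edgeImage.1 (hE he)
    exact ⟨s(a, b), rfl⟩
  have hedges : M'.edgeSet = φ.sym2Map ⁻¹' E := by
    ext e
    induction e with
    | _ a b => exact Iff.rfl
  have hverts_card : M'.verts.ncard = S.card := by
    rw [Set.ncard_preimage_of_injective_subset_range φ.injective hSrange, Set.ncard_coe_finset]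
  have hedges_card : M'.edgeSet.ncard = E.card := by
    rw [hedges, Set.ncard_preimage_of_injective_subset_range φ.sym2Map.injective hErange,
      Set.ncard_coe_finset]
  rw [← hverts_card, ← hedges_card]
  exact hsub M' (Set.Nonempty.preimage' hne hSrange)

end Vertices

lemma nonempty_iso_of_edgeImage_eq (hM : M.graph.Connected) (hN : N.graph.Connected)
    (heM : 1 ≤ M.e) (heN : 1 ≤ N.e) {ψ : Fin N.v ↪ V} (h : edgeImage M φ = edgeImage N ψ) :
    Nonempty (M.graph ≃g N.graph) := by
  classical
  have hrange : Set.range φ = Set.range ψ := by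
    have := congrArg (fun E => (verts E : Set V)) h
    simpa [verts_edgeImage hM heM, verts_edgeImage hN heN] using this
  let f : Fin M.v ≃ Fin N.v := (Equiv.ofInjective φ φ.injective).trans
    ((Equiv.setCongr hrange).trans (Equiv.ofInjective ψ ψ.injective).symm)
  have hf (a : Fin M.v) : ψ (f a) = φ a := by
    simp [f, Equiv.apply_ofInjective_symm]
  refine ⟨⟨f, fun {a b} => ?_⟩⟩
  rw [← mk_mem_edgeImage (φ := ψ), ← mk_mem_edgeImage (φ := φ), hf, hf, h]

end Copies

section Moments

instance instMeasurableSingletonClassSimpleGraph (n : ℕ) :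
    MeasurableSingletonClass (SimpleGraph (Fin n)) where
  measurableSet_singleton G := by
    have h := SimpleGraph.measurableEmbedding_edgeSet (V := Fin n)
    rw [← h.measurableSet_image, Set.image_singleton]
    exact measurableSet_singleton _

/-- The variance of a Bernoulli(`p`) variable. -/
def bernoulliVar (p : I) : ℝ := p * (1 - p)

/-- The mixed moment `E[(X - p)ⁱ (Y - p)ʲ]` of a pair of Bernoulli(`p`) variables with
correlation coefficient `ρ`. -/
noncomputable def moment (p ρ : I) (i j : ℕ) : ℝ :=
  ∫ b : Bool × Bool, ((if b.1 then (1 : ℝ) else 0) - p) ^ i *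
    ((if b.2 then (1 : ℝ) else 0) - p) ^ j ∂correlatedBernoulli p ρ

variable {p ρ : I}

lemma bernoulliVar_nonneg (p : I) : 0 ≤ bernoulliVar p :=
  mul_nonneg p.2.1 (sub_nonneg.2 p.2.2)

lemma bernoulliVar_le (p : I) : bernoulliVar p ≤ 1 / 4 := by
  unfold bernoulliVar
  nlinarith [sq_nonneg ((p : ℝ) - 1 / 2)]

lemma correlatedBernoulli_weights_nonneg (p ρ : I) :
    0 ≤ (p : ℝ) ^ 2 + ρ * (p * (1 - p)) ∧ 0 ≤ (1 - ρ : ℝ) * (p * (1 - p)) ∧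
      0 ≤ (1 - (p : ℝ)) ^ 2 + ρ * (p * (1 - p)) := by
  have hs := bernoulliVar_nonneg p
  have hρs := mul_nonneg ρ.2.1 hs
  exact ⟨add_nonneg (sq_nonneg _) hρs, mul_nonneg (sub_nonneg.2 ρ.2.2) hs,
    add_nonneg (sq_nonneg _) hρs⟩

instance isProbabilityMeasure_correlatedBernoulli (p ρ : I) :
    IsProbabilityMeasure (correlatedBernoulli p ρ) := by
  obtain ⟨h₁, h₂, h₃⟩ := correlatedBernoulli_weights_nonneg p ρ
  constructor
  simp only [correlatedBernoulli, Measure.coe_add, Pi.add_apply, Measure.smul_apply, measure_univ,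
    smul_eq_mul, mul_one]
  rw [← ENNReal.ofReal_add h₁ h₂, ← ENNReal.ofReal_add (add_nonneg h₁ h₂) h₂,
    ← ENNReal.ofReal_add (add_nonneg (add_nonneg h₁ h₂) h₂) h₃, ← ENNReal.ofReal_one]
  congr 1
  ring

lemma moment_eq (p ρ : I) (i j : ℕ) : moment p ρ i j =
    ((p : ℝ) ^ 2 + ρ * (p * (1 - p))) * ((1 - p) ^ i * (1 - p) ^ j)
      + (1 - ρ) * (p * (1 - p)) * ((1 - p) ^ i * (-p) ^ j)
      + (1 - ρ) * (p * (1 - p)) * ((-p) ^ i * (1 - p) ^ j)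
      + ((1 - (p : ℝ)) ^ 2 + ρ * (p * (1 - p))) * ((-p) ^ i * (-p) ^ j) := by
  obtain ⟨h₁, h₂, h₃⟩ := correlatedBernoulli_weights_nonneg p ρ
  have integrable (c : ℝ) (b : Bool × Bool) (f : Bool × Bool → ℝ) :
      Integrable f (ENNReal.ofReal c • Measure.dirac b) :=
    Integrable.of_finite.smul_measure ENNReal.ofReal_ne_top
  rw [moment, correlatedBernoulli, integral_add_measure
      (((integrable _ _ _).add_measure (integrable _ _ _)).add_measure (integrable _ _ _))
      (integrable _ _ _),
    integral_add_measure ((integrable _ _ _).add_measure (integrable _ _ _)) (integrable _ _ _),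
    integral_add_measure (integrable _ _ _) (integrable _ _ _)]
  simp [integral_smul_measure, integral_dirac, ENNReal.toReal_ofReal, h₁, h₂, h₃]

lemma moment_comm (p ρ : I) (i j : ℕ) : moment p ρ i j = moment p ρ j i := by
  simp only [moment_eq]; ring

lemma moment_zero_zero : moment p ρ 0 0 = 1 := by simp only [moment_eq]; ring

lemma moment_one_zero : moment p ρ 1 0 = 0 := by simp only [moment_eq]; ring

lemma moment_one_one : moment p ρ 1 1 = ρ * bernoulliVar p := by
  simp only [moment_eq, bernoulliVar]; ring

lemma moment_two_zero : moment p ρ 2 0 = bernoulliVar p := by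
  simp only [moment_eq, bernoulliVar]; ring

lemma moment_two_one : moment p ρ 2 1 = bernoulliVar p * ((1 - 2 * p) * ρ) := by
  simp only [moment_eq, bernoulliVar]; ring

lemma moment_two_two :
    moment p ρ 2 2 = bernoulliVar p * (bernoulliVar p + (1 - 4 * bernoulliVar p) * ρ) := by
  simp only [moment_eq, bernoulliVar]; ring

lemma moment_eq_zero {i j : ℕ} (h : i + j = 1) : moment p ρ i j = 0 := by
  obtain ⟨rfl, rfl⟩ | ⟨rfl, rfl⟩ : i = 1 ∧ j = 0 ∨ i = 0 ∧ j = 1 := by omega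
  · exact moment_one_zero
  · rw [moment_comm, moment_one_zero]

lemma abs_moment_two_le {j : ℕ} (hj : j ≤ 2) : |moment p ρ 2 j| ≤ bernoulliVar p := by
  have hs := bernoulliVar_nonneg p
  have hs' := bernoulliVar_le p
  obtain ⟨hp₀, hp₁⟩ := p.2
  obtain ⟨hρ₀, hρ₁⟩ := ρ.2
  interval_cases j
  · rw [moment_two_zero, abs_of_nonneg hs]
  · rw [moment_two_one, abs_mul, abs_of_nonneg hs]
    refine mul_le_of_le_one_right hs ?_
    rw [abs_mul, abs_of_nonneg hρ₀]
    exact mul_le_one₀ (abs_le.2 ⟨by linarith, by linarith⟩) hρ₀ hρ₁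
  · rw [moment_two_two, abs_mul, abs_of_nonneg hs]
    refine mul_le_of_le_one_right hs ?_
    have hρ : (1 - 4 * bernoulliVar p) * ρ ≤ (1 - 4 * bernoulliVar p) * 1 :=
      mul_le_mul_of_nonneg_left hρ₁ (by linarith)
    have hρ' : 0 ≤ (1 - 4 * bernoulliVar p) * ρ := mul_nonneg (by linarith) hρ₀
    rw [abs_of_nonneg (by linarith)]
    linarith

lemma abs_moment_le {i j : ℕ} (hi : i ≤ 2) (hj : j ≤ 2) (hij : 2 ≤ i + j) :
    |moment p ρ i j| ≤ bernoulliVar p := by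
  obtain rfl | rfl | ⟨rfl, rfl⟩ : i = 2 ∨ j = 2 ∨ i = 1 ∧ j = 1 := by omega
  · exact abs_moment_two_le hj
  · rw [moment_comm]
    exact abs_moment_two_le hi
  · rw [moment_one_one, abs_of_nonneg (mul_nonneg ρ.2.1 (bernoulliVar_nonneg p))]
    exact mul_le_of_le_one_left (bernoulliVar_nonneg p) ρ.2.2

section Products

variable {α : Type*} [Fintype α] [DecidableEq α] {A B C D : Finset α}

lemma prod_ite_mem_eq_pow_card {R : Type*} [CommMonoid R] (A : Finset α) (c : R) :
    ∏ x, (if x ∈ A then c else 1) = c ^ A.card := by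
  rw [Finset.prod_ite_mem, Finset.univ_inter, Finset.prod_const]

lemma prod_moment_eq_zero (h : ¬ IsDoubleCover A B C D) :
    ∏ x, moment p ρ (mult A B x) (mult C D x) = 0 := by
  obtain ⟨x, hx⟩ := not_forall_not.1 h
  exact Finset.prod_eq_zero (Finset.mem_univ x) (moment_eq_zero hx)

lemma prod_moment_mult_mult (h : Disjoint A B) :
    ∏ x, moment p ρ (mult A B x) (mult A B x) = (ρ * bernoulliVar p) ^ (A.card + B.card) := by
  rw [← Finset.card_union_of_disjoint h, ← prod_ite_mem_eq_pow_card]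
  refine Finset.prod_congr rfl fun x _ => ?_
  have hx : x ∈ A → x ∉ B := fun hA hB => Finset.disjoint_left.1 h hA hB
  by_cases hA : x ∈ A <;> by_cases hB : x ∈ B <;>
    simp_all [mult, moment_zero_zero, moment_one_one]

lemma prod_moment_mult_self (h : Disjoint A B) :
    ∏ x, moment p ρ (mult A A x) (mult B B x) = bernoulliVar p ^ (A.card + B.card) := by
  rw [← Finset.card_union_of_disjoint h, ← prod_ite_mem_eq_pow_card]
  refine Finset.prod_congr rfl fun x _ => ?_
  have hx : x ∈ A → x ∉ B := fun hA hB => Finset.disjoint_left.1 h hA hB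
  by_cases hA : x ∈ A <;> by_cases hB : x ∈ B <;>
    simp_all [mult, moment_zero_zero, moment_two_zero, moment_comm p ρ 0 2]

lemma prod_moment_le (h : IsDoubleCover A B C D) :
    ∏ x, moment p ρ (mult A B x) (mult C D x) ≤ bernoulliVar p ^ (A ∪ B ∪ (C ∪ D)).card := by
  rw [← prod_ite_mem_eq_pow_card]
  refine (le_abs_self _).trans ?_
  rw [Finset.abs_prod]
  refine Finset.prod_le_prod (fun _ _ => abs_nonneg _) fun x _ => ?_
  split_ifs with hx
  · refine abs_moment_le (mult_le_two _ _ _) (mult_le_two _ _ _) ?_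
    have := h x
    simp only [mult, Finset.mem_union] at this hx ⊢
    grind
  · have hA : mult A B x = 0 := by simp_all [mult]
    have hC : mult C D x = 0 := by simp_all [mult]
    rw [hA, hC, moment_zero_zero, abs_one]

end Products

section Characters

variable {n : ℕ}

/-- The product of the centered edge indicators of a graph over a set of edges. -/
noncomputable def character (p : I) (A : Finset (Sym2 (Fin n))) (G : SimpleGraph (Fin n)) : ℝ :=
  ∏ e ∈ A, centered p G e

lemma injCount_centered (p : I) (M : Motif) (G : SimpleGraph (Fin n)) :
    injCount M (centered p G) = ∑ φ : Fin M.v ↪ Fin n, character p (edgeImage M φ) G := by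
  classical
  simp only [injCount, character, edgeImage, Finset.prod_map, Function.Embedding.sym2Map_apply]

lemma centered_map (p : I) (π : Equiv.Perm (Fin n)) (G : SimpleGraph (Fin n))
    (e : Sym2 (Fin n)) : centered p (G.map π) (e.map π) = centered p G e := by
  have h : e.map π ∈ (G.map π).edgeSet ↔ e ∈ G.edgeSet := by
    induction e with
    | _ a b => exact SimpleGraph.map_adj_apply (f := π.toEmbedding)
  unfold centered
  by_cases he : e ∈ G.edgeSet
  · rw [if_pos he, if_pos (h.2 he)]
  · rw [if_neg he, if_neg (mt h.1 he)]

lemma injCount_map (p : I) (M : Motif) (π : Equiv.Perm (Fin n)) (G : SimpleGraph (Fin n)) :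
    injCount M (centered p (G.map π)) = injCount M (centered p G) := by
  classical
  refine (Fintype.sum_equiv (Equiv.embeddingCongr (Equiv.refl _) π) _ _ fun φ =>
    Finset.prod_congr rfl fun e _ => ?_).symm
  rw [← centered_map p π, Sym2.map_map]
  rfl

lemma character_mul_character {A B : Finset (Sym2 (Fin n))} (p : I) (G : SimpleGraph (Fin n)) :
    character p A G * character p B G = ∏ e, centered p G e ^ mult A B e := by
  simp only [character, mult, pow_add, pow_ite, pow_one, pow_zero, Finset.prod_mul_distrib,
    Finset.prod_ite_mem, Finset.univ_inter]

lemma mult_eq_zero_of_isDiag {A B : Finset (Sym2 (Fin n))} (hA : ∀ e ∈ A, ¬ e.IsDiag)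
    (hB : ∀ e ∈ B, ¬ e.IsDiag) {e : Sym2 (Fin n)} (he : e.IsDiag) : mult A B e = 0 := by
  rw [mult, if_neg fun h => hA e h he, if_neg fun h => hB e h he]

/-- The law of the indicator of an unordered pair of vertices in a binomial random graph, as a
measure on `Prop`; the loops are never present. -/
noncomputable def edgeLaw (p : I) (e : Sym2 (Fin n)) : Measure Prop :=
  toNNReal p • Measure.dirac (e ∈ (Sym2.diagSet : Set (Sym2 (Fin n)))ᶜ)
    + toNNReal (σ p) • Measure.dirac False

instance isProbabilityMeasure_edgeLaw (p : I) (e : Sym2 (Fin n)) :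
    IsProbabilityMeasure (edgeLaw p e) := by
  constructor
  simp only [edgeLaw, measure_univ]

lemma integral_binomialRandom (p : I) (f : SimpleGraph (Fin n) → ℝ) :
    ∫ G, f G ∂SimpleGraph.binomialRandom (Fin n) p
      = ∫ P, f (SimpleGraph.fromEdgeSet {e | P e}) ∂Measure.pi (edgeLaw (n := n) p) := by
  rw [SimpleGraph.binomialRandom_eq_map, ProbabilityTheory.setBernoulli_eq_map,
    integral_map SimpleGraph.measurable_fromEdgeSet.aemeasurable
      (measurable_of_finite _).aestronglyMeasurable,
    integral_map (measurable_of_finite _).aemeasurable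
      (measurable_of_finite _).aestronglyMeasurable, ← Measure.infinitePi_eq_pi]
  rfl

open Classical in
lemma integral_edgeLaw (p : I) {e : Sym2 (Fin n)} {i : ℕ} (hi : i ≤ 2) (he : e.IsDiag → i = 0) :
    ∫ P : Prop, ((if P then (1 : ℝ) else 0) - p) ^ i ∂edgeLaw p e = moment p 0 i 0 := by
  obtain rfl | hi₀ := eq_or_ne i 0
  · simp [moment_zero_zero]
  have hmem : (e ∈ (Sym2.diagSet : Set (Sym2 (Fin n)))ᶜ) = True := by simpa using mt he hi₀
  rw [edgeLaw, hmem, integral_add_measure Integrable.of_finite Integrable.of_finite,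
    integral_smul_nnreal_measure, integral_smul_nnreal_measure, integral_dirac, integral_dirac]
  obtain rfl | rfl : i = 1 ∨ i = 2 := by omega
  · simp only [↓reduceIte, pow_one, NNReal.smul_def, coe_toNNReal, smul_eq_mul, zero_sub, smul_neg,
      coe_symm_eq, moment_one_zero]
    ring
  · simp only [↓reduceIte, NNReal.smul_def, coe_toNNReal, smul_eq_mul, zero_sub, even_two,
      Even.neg_pow, coe_symm_eq, moment_two_zero, bernoulliVar]
    ring

lemma integral_binomialRandom_character_mul (p : I) {A B : Finset (Sym2 (Fin n))}
    (hA : ∀ e ∈ A, ¬ e.IsDiag) (hB : ∀ e ∈ B, ¬ e.IsDiag) :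
    ∫ G, character p A G * character p B G ∂SimpleGraph.binomialRandom (Fin n) p
      = if A = B then bernoulliVar p ^ A.card else 0 := by
  classical
  have pointwise (P : Sym2 (Fin n) → Prop) :
      character p A (SimpleGraph.fromEdgeSet {e | P e})
        * character p B (SimpleGraph.fromEdgeSet {e | P e})
        = ∏ e, ((if P e then (1 : ℝ) else 0) - p) ^ mult A B e := by
    rw [character_mul_character]
    refine Finset.prod_congr rfl fun e _ => ?_
    by_cases he : e.IsDiag
    · simp only [mult_eq_zero_of_isDiag hA hB he, pow_zero]
    · simp [centered, he]
  have hprod : ∫ G, character p A G * character p B G ∂SimpleGraph.binomialRandom (Fin n) p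
      = ∏ e, moment p 0 (mult A B e) (mult ∅ ∅ e) := by
    simp only [integral_binomialRandom, pointwise]
    rw [integral_fintype_prod_eq_prod (𝕜 := ℝ) (E := fun _ => Prop)
      (fun e (P : Prop) => ((if P then (1 : ℝ) else 0) - p) ^ mult A B e)]
    exact Finset.prod_congr rfl fun e _ =>
      integral_edgeLaw p (mult_le_two _ _ _) fun he => mult_eq_zero_of_isDiag hA hB he
  rw [hprod]
  split_ifs with h
  · subst h
    simpa using prod_moment_mult_self (Finset.disjoint_empty_right A)
  · refine prod_moment_eq_zero fun hcover => h ?_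
    rw [isDoubleCover_iff] at hcover
    exact (by simpa using hcover.1 : A ⊆ B).antisymm (by simpa using hcover.2.1)

/-- The law of the independent pairs of correlated bits that `graphPair` turns into two graphs. -/
noncomputable def bitLaw (n : ℕ) (p ρ : I) : Measure (Sym2 (Fin n) → Bool × Bool) :=
  Measure.pi fun _ => correlatedBernoulli p ρ

instance isProbabilityMeasure_bitLaw (n : ℕ) (p ρ : I) : IsProbabilityMeasure (bitLaw n p ρ) :=
  inferInstanceAs (IsProbabilityMeasure (Measure.pi _))

lemma centered_graphPair_fst (p : I) (x : Sym2 (Fin n) → Bool × Bool) {e : Sym2 (Fin n)}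
    (he : ¬ e.IsDiag) :
    centered p (graphPair 1 x).1 e = (if (x e).1 then (1 : ℝ) else 0) - p := by
  simp [centered, graphPair, he]

lemma centered_graphPair_snd (p : I) (x : Sym2 (Fin n) → Bool × Bool) {e : Sym2 (Fin n)}
    (he : ¬ e.IsDiag) :
    centered p (graphPair 1 x).2 e = (if (x e).2 then (1 : ℝ) else 0) - p := by
  have h := centered_map p 1 (SimpleGraph.fromEdgeSet {e | (x e).2 = true}) e
  rw [show e.map (1 : Equiv.Perm (Fin n)) = e from Sym2.map_id' ▸ rfl] at h
  rw [graphPair, h]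
  simp [centered, he]

lemma integral_bitLaw_character (p ρ : I) {A B C D : Finset (Sym2 (Fin n))}
    (hA : ∀ e ∈ A, ¬ e.IsDiag) (hB : ∀ e ∈ B, ¬ e.IsDiag)
    (hC : ∀ e ∈ C, ¬ e.IsDiag) (hD : ∀ e ∈ D, ¬ e.IsDiag) :
    ∫ x, character p A (graphPair 1 x).1 * character p B (graphPair 1 x).1
        * (character p C (graphPair 1 x).2 * character p D (graphPair 1 x).2) ∂bitLaw n p ρ
      = ∏ e, moment p ρ (mult A B e) (mult C D e) := by
  have pointwise (x : Sym2 (Fin n) → Bool × Bool) :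
      character p A (graphPair 1 x).1 * character p B (graphPair 1 x).1
        * (character p C (graphPair 1 x).2 * character p D (graphPair 1 x).2)
      = ∏ e, (((if (x e).1 then (1 : ℝ) else 0) - p) ^ mult A B e
          * ((if (x e).2 then (1 : ℝ) else 0) - p) ^ mult C D e) := by
    rw [character_mul_character, character_mul_character, ← Finset.prod_mul_distrib]
    refine Finset.prod_congr rfl fun e _ => ?_
    by_cases he : e.IsDiag
    · simp only [mult_eq_zero_of_isDiag hA hB he, mult_eq_zero_of_isDiag hC hD he, pow_zero]
    · rw [centered_graphPair_fst p x he, centered_graphPair_snd p x he]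
  simp only [pointwise]
  exact integral_fintype_prod_eq_prod (𝕜 := ℝ) (fun e (b : Bool × Bool) =>
    ((if b.1 then (1 : ℝ) else 0) - p) ^ mult A B e
      * ((if b.2 then (1 : ℝ) else 0) - p) ^ mult C D e)

end Characters

end Moments

section SecondMoments

section EdgeSets

variable {V : Type*} [Fintype V] [DecidableEq V] {p ρ : I} {r N : ℝ} {A B C D : Finset (Sym2 V)}

lemma prod_moment_le_of_not_hasTriple (hcover : IsDoubleCover A B C D) (hA : IsEdgeConnected A)
    (hB : IsEdgeConnected B) (hC : IsEdgeConnected C) (hD : IsEdgeConnected D)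
    (hAC : A.card = C.card) (htriple : ¬ HasTriple A B C D) :
    ∏ e, moment p ρ (mult A B e) (mult C D e) ≤
      (ρ * bernoulliVar p) ^ (A.card + B.card) *
          ((if A = C then 1 else 0) * (if B = D then 1 else 0))
        + bernoulliVar p ^ (A.card + B.card) *
          ((if A = B then 1 else 0) * (if C = D then 1 else 0)
            + (if A = D then 1 else 0) * (if C = B then 1 else 0)) := by
  have hs := bernoulliVar_nonneg p
  have hρs : 0 ≤ ρ * bernoulliVar p := mul_nonneg ρ.2.1 hs
  have hρs_le : (ρ * bernoulliVar p) ^ (A.card + B.card) ≤ bernoulliVar p ^ (A.card + B.card) :=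
    pow_le_pow_left₀ hρs (mul_le_of_le_one_left hs ρ.2.2) _
  obtain ⟨rfl, rfl, hdisj⟩ | ⟨rfl, rfl, hdisj⟩ | ⟨rfl, rfl, hdisj⟩ :=
    hcover.pairing hA hB hC hD htriple
  · rw [prod_moment_mult_self hdisj, ← hAC, if_pos rfl, if_pos rfl]
    refine le_add_of_nonneg_of_le (by positivity) (le_mul_of_one_le_right (by positivity) ?_)
    rw [mul_one]
    exact le_add_of_nonneg_right (by positivity)
  · rw [prod_moment_mult_mult hdisj, if_pos rfl, if_pos rfl, mul_one, mul_one]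
    exact le_add_of_nonneg_right (by positivity)
  · have hcomm (e : Sym2 V) : mult B A e = mult A B e := add_comm _ _
    simp only [hcomm, ↓reduceIte]
    rw [prod_moment_mult_mult hdisj]
    refine le_add_of_nonneg_of_le (by positivity)
      (hρs_le.trans (le_mul_of_one_le_right (by positivity) ?_))
    rw [mul_one]
    exact le_add_of_nonneg_left (by positivity)

lemma prod_moment_le_of_isDense (hA : IsEdgeConnected A) (hB : IsEdgeConnected B)
    (hC : IsEdgeConnected C) (hD : IsEdgeConnected D) (hAC : A.card = C.card)
    (hBD : B.card = D.card) (hAC' : (verts A).card = (verts C).card)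
    (hBD' : (verts B).card = (verts D).card) (hdenseA : IsDense (r ^ 2) N (bernoulliVar p) A)
    (hdenseC : IsDense (r ^ 2) N (bernoulliVar p) C) (hr : 1 ≤ r) (hN : 0 < N) :
    ∏ e, moment p ρ (mult A B e) (mult C D e) ≤
      (ρ * bernoulliVar p) ^ (A.card + B.card) *
          ((if A = C then 1 else 0) * (if B = D then 1 else 0))
        + bernoulliVar p ^ (A.card + B.card) *
          ((if A = B then 1 else 0) * (if C = D then 1 else 0)
            + (if A = D then 1 else 0) * (if C = B then 1 else 0))
        + bernoulliVar p ^ (A.card + B.card) * N ^ ((verts A).card + (verts B).card) / r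
          * (N ^ (verts (A ∪ B ∪ (C ∪ D))).card)⁻¹ := by
  have hs := bernoulliVar_nonneg p
  have hρs : 0 ≤ ρ * bernoulliVar p := mul_nonneg ρ.2.1 hs
  have pairing_nonneg : 0 ≤ (ρ * bernoulliVar p) ^ (A.card + B.card) *
          ((if A = C then 1 else 0) * (if B = D then 1 else 0))
        + bernoulliVar p ^ (A.card + B.card) *
          ((if A = B then 1 else 0) * (if C = D then 1 else 0)
            + (if A = D then 1 else 0) * (if C = B then 1 else 0)) := by
    positivity
  have overlap_nonneg : 0 ≤ bernoulliVar p ^ (A.card + B.card)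
      * N ^ ((verts A).card + (verts B).card) / r * (N ^ (verts (A ∪ B ∪ (C ∪ D))).card)⁻¹ := by
    positivity
  by_cases hcover : IsDoubleCover A B C D
  · by_cases htriple : HasTriple A B C D
    · exact (prod_moment_le hcover).trans <| (hcover.pow_card_le htriple hdenseA hdenseC hAC hBD
        hAC' hBD' hr hN hs).trans (le_add_of_nonneg_left pairing_nonneg)
    · exact (prod_moment_le_of_not_hasTriple hcover hA hB hC hD hAC htriple).trans
        (le_add_of_nonneg_right overlap_nonneg)
  · rw [prod_moment_eq_zero hcover]
    exact add_nonneg pairing_nonneg overlap_nonneg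

end EdgeSets

section Quadruples

variable {V : Type*} [DecidableEq V] {M N : Motif}

/-- Quadruples of two copies of `M` and two copies of `N`. -/
abbrev Quad (V : Type*) (M N : Motif) : Type _ :=
  ((Fin M.v ↪ V) × (Fin M.v ↪ V)) × ((Fin N.v ↪ V) × (Fin N.v ↪ V))

/-- The edges of the four copies of a quadruple. -/
noncomputable def Quad.edges (x : Quad V M N) : Finset (Sym2 V) :=
  edgeImage M x.1.1 ∪ edgeImage N x.2.1 ∪ (edgeImage M x.1.2 ∪ edgeImage N x.2.2)

lemma Quad.verts_edges (hM : M.graph.Connected) (hN : N.graph.Connected) (heM : 1 ≤ M.e)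
    (heN : 1 ≤ N.e) (x : Quad V M N) : verts x.edges =
      Finset.univ.image (Sum.elim (Sum.elim x.1.1 x.1.2) (Sum.elim x.2.1 x.2.2)) := by
  ext w
  simp only [Quad.edges, verts_union, verts_edgeImage hM heM, verts_edgeImage hN heN,
    Finset.mem_union, Finset.mem_map, Finset.mem_image, Finset.mem_univ, true_and, Sum.exists,
    Sum.elim_inl, Sum.elim_inr]
  tauto

variable [Fintype V]

/-- The number of pairs of a copy of `M` and a copy of `N` in `V` with the same edges. -/
noncomputable def coincidences (V : Type*) [Fintype V] [DecidableEq V] (M N : Motif) : ℝ :=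
  ∑ x : (Fin M.v ↪ V) × (Fin N.v ↪ V), if edgeImage M x.1 = edgeImage N x.2 then 1 else 0

lemma coincidences_nonneg (M N : Motif) : 0 ≤ coincidences V M N :=
  Finset.sum_nonneg fun _ _ => by positivity

lemma sum_quad_same (M N : Motif) :
    ∑ x : Quad V M N, (if edgeImage M x.1.1 = edgeImage M x.1.2 then (1 : ℝ) else 0)
          * (if edgeImage N x.2.1 = edgeImage N x.2.2 then 1 else 0)
      = coincidences V M M * coincidences V N N := by
  rw [coincidences, coincidences, Finset.sum_mul_sum, Fintype.sum_prod_type]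

lemma sum_quad_parallel (M N : Motif) :
    ∑ x : Quad V M N, (if edgeImage M x.1.1 = edgeImage N x.2.1 then (1 : ℝ) else 0)
          * (if edgeImage M x.1.2 = edgeImage N x.2.2 then 1 else 0)
      = coincidences V M N ^ 2 := by
  rw [coincidences, sq, Finset.sum_mul_sum, ← Fintype.sum_prod_type']
  exact Fintype.sum_equiv (Equiv.prodProdProdComm _ _ _ _) _ _ fun x => rfl

lemma sum_quad_crossed (M N : Motif) :
    ∑ x : Quad V M N, (if edgeImage M x.1.1 = edgeImage N x.2.2 then (1 : ℝ) else 0)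
          * (if edgeImage M x.1.2 = edgeImage N x.2.1 then 1 else 0)
      = coincidences V M N ^ 2 := by
  rw [← sum_quad_parallel]
  exact Fintype.sum_equiv (Equiv.prodCongr (Equiv.refl _) (Equiv.prodComm _ _)) _ _ fun x => rfl

lemma sum_inv_pow_card_verts_edges_le [Nonempty V] (hM : M.graph.Connected)
    (hN : N.graph.Connected) (heM : 1 ≤ M.e) (heN : 1 ≤ N.e) :
    ∑ x : Quad V M N, ((Fintype.card V : ℝ) ^ (verts x.edges).card)⁻¹
      ≤ (2 * (M.v + N.v)).factorial := by
  let f (x : Quad V M N) : (Fin M.v ⊕ Fin M.v) ⊕ (Fin N.v ⊕ Fin N.v) → V :=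
    Sum.elim (Sum.elim x.1.1 x.1.2) (Sum.elim x.2.1 x.2.2)
  have hf : Function.Injective f := by
    rintro ⟨⟨a, b⟩, c, d⟩ ⟨⟨a', b'⟩, c', d'⟩ h
    simpa [f, Sum.elim_eq_iff] using h
  have hcard : Fintype.card ((Fin M.v ⊕ Fin M.v) ⊕ (Fin N.v ⊕ Fin N.v)) = 2 * (M.v + N.v) := by
    simp only [Fintype.card_sum, Fintype.card_fin]
    ring
  rw [← hcard]
  refine le_trans ?_ (sum_inv_card_pow_card_image_le (V := V))
  simp only [Quad.verts_edges hM hN heM heN]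
  calc _ = ∑ g ∈ Finset.univ.map ⟨f, hf⟩,
        ((Fintype.card V : ℝ) ^ (Finset.univ.image g).card)⁻¹ := by rw [Finset.sum_map]; rfl
    _ ≤ _ := Finset.sum_le_sum_of_subset_of_nonneg (Finset.subset_univ _)
        fun _ _ _ => by positivity

end Quadruples

end SecondMoments

section Coincidences

variable {V : Type*} [Fintype V] [DecidableEq V] {F : Finset Motif} {M N : Motif}

lemma descFactorial_le_coincidences (V : Type*) [Fintype V] [DecidableEq V] (M : Motif) :
    ((Fintype.card V).descFactorial M.v : ℝ) ≤ coincidences V M M := by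
  calc ((Fintype.card V).descFactorial M.v : ℝ) = ∑ _φ : Fin M.v ↪ V, (1 : ℝ) := by
        simp [Fintype.card_embedding_eq]
    _ ≤ coincidences V M M := by
      rw [coincidences, Fintype.sum_prod_type]
      refine Finset.sum_le_sum fun φ _ => ?_
      calc (1 : ℝ) = if edgeImage M φ = edgeImage M φ then 1 else 0 := (if_pos rfl).symm
        _ ≤ _ := Finset.single_le_sum (f := fun ψ : Fin M.v ↪ V =>
            if edgeImage M φ = edgeImage M ψ then (1 : ℝ) else 0)
            (fun _ _ => by positivity) (Finset.mem_univ φ)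

lemma coincidences_eq_zero (hF : IsMotifFamily F) (hconn : ∀ M ∈ F, M.graph.Connected)
    (he : ∀ M ∈ F, 1 ≤ M.e) (hM : M ∈ F) (hN : N ∈ F) (hne : M ≠ N) :
    coincidences V M N = 0 :=
  Finset.sum_eq_zero fun _ _ => if_neg fun h => hne <| hF M hM N hN <|
    nonempty_iso_of_edgeImage_eq (hconn M hM) (hconn N hN) (he M hM) (he N hN) h

lemma prod_moment_quad_le {p ρ : I} {r n : ℝ} (hM : M.graph.Connected) (hN : N.graph.Connected)
    (heM : 1 ≤ M.e) (heN : 1 ≤ N.e)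
    (hdense : ∀ φ : Fin M.v ↪ V, IsDense (r ^ 2) n (bernoulliVar p) (edgeImage M φ))
    (hr : 1 ≤ r) (hn : 0 < n) (x : Quad V M N) :
    ∏ e, moment p ρ (mult (edgeImage M x.1.1) (edgeImage N x.2.1) e)
        (mult (edgeImage M x.1.2) (edgeImage N x.2.2) e) ≤
      (ρ * bernoulliVar p) ^ (M.e + N.e) *
          ((if edgeImage M x.1.1 = edgeImage M x.1.2 then 1 else 0)
            * (if edgeImage N x.2.1 = edgeImage N x.2.2 then 1 else 0))
        + bernoulliVar p ^ (M.e + N.e) *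
          ((if edgeImage M x.1.1 = edgeImage N x.2.1 then 1 else 0)
              * (if edgeImage M x.1.2 = edgeImage N x.2.2 then 1 else 0)
            + (if edgeImage M x.1.1 = edgeImage N x.2.2 then 1 else 0)
              * (if edgeImage M x.1.2 = edgeImage N x.2.1 then 1 else 0))
        + bernoulliVar p ^ (M.e + N.e) * n ^ (M.v + N.v) / r * (n ^ (verts x.edges).card)⁻¹ := by
  have h := prod_moment_le_of_isDense (ρ := ρ)
    (isEdgeConnected_edgeImage hM heM x.1.1) (isEdgeConnected_edgeImage hN heN x.2.1)
    (isEdgeConnected_edgeImage hM heM x.1.2) (isEdgeConnected_edgeImage hN heN x.2.2)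
    (by rw [card_edgeImage, card_edgeImage]) (by rw [card_edgeImage, card_edgeImage])
    (by rw [card_verts_edgeImage hM heM, card_verts_edgeImage hM heM])
    (by rw [card_verts_edgeImage hN heN, card_verts_edgeImage hN heN])
    (hdense x.1.1) (hdense x.1.2) hr hn
  rwa [card_edgeImage, card_edgeImage, card_verts_edgeImage hM heM,
    card_verts_edgeImage hN heN] at h

end Coincidences

section Integrals

variable {n : ℕ} {p ρ : I} {F : Finset Motif} {M N : Motif}

/-- The variance `E[inj(M, Ḡ)²]` of the injective count of `M` in a binomial random graph
`G ∼ 𝒢(n, p)`. -/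
noncomputable def injVariance (n : ℕ) (p : I) (M : Motif) : ℝ :=
  coincidences (Fin n) M M * bernoulliVar p ^ M.e

/-- The weight of a motif in the test statistic: the ratio of the mean of
`inj(M, Ḡ₁) inj(M, Ḡ₂)` under the alternative to its variance under the null hypothesis. -/
noncomputable def weight (n : ℕ) (p ρ : I) (M : Motif) : ℝ := (ρ : ℝ) ^ M.e / injVariance n p M

/-- The mixed fourth moment `E[inj(M, Ḡ₁) inj(N, Ḡ₁) inj(M, Ḡ₂) inj(N, Ḡ₂)]` under the
alternative. -/
noncomputable def mixedMoment (n : ℕ) (p ρ : I) (M N : Motif) : ℝ :=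
  ∫ x, injCount M (centered p (graphPair 1 x).1) * injCount N (centered p (graphPair 1 x).1)
    * (injCount M (centered p (graphPair 1 x).2) * injCount N (centered p (graphPair 1 x).2))
    ∂bitLaw n p ρ

lemma injVariance_nonneg (n : ℕ) (p : I) (M : Motif) : 0 ≤ injVariance n p M :=
  mul_nonneg (coincidences_nonneg M M) (pow_nonneg (bernoulliVar_nonneg p) _)

lemma weight_nonneg (n : ℕ) (p ρ : I) (M : Motif) : 0 ≤ weight n p ρ M :=
  div_nonneg (pow_nonneg ρ.2.1 _) (injVariance_nonneg n p M)

lemma integral_injCount_mul (p : I) (M N : Motif) :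
    ∫ G : SimpleGraph (Fin n), injCount M (centered p G) * injCount N (centered p G)
      ∂SimpleGraph.binomialRandom (Fin n) p = coincidences (Fin n) M N * bernoulliVar p ^ M.e := by
  simp only [injCount_centered, Finset.sum_mul_sum, ← Fintype.sum_prod_type']
  rw [integral_finsetSum _ fun _ _ => Integrable.of_finite, coincidences, Finset.sum_mul]
  refine Finset.sum_congr rfl fun x _ => ?_
  rw [integral_binomialRandom_character_mul p (fun e => not_isDiag_of_mem_edgeImage)
    (fun e => not_isDiag_of_mem_edgeImage), card_edgeImage, ite_mul, one_mul, zero_mul]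

lemma integral_injCount_mul_graphPair (p ρ : I) (M : Motif) :
    ∫ x, injCount M (centered p (graphPair 1 x).1) * injCount M (centered p (graphPair 1 x).2)
      ∂bitLaw n p ρ = ρ ^ M.e * injVariance n p M := by
  simp only [injCount_centered, Finset.sum_mul_sum, ← Fintype.sum_prod_type']
  rw [integral_finsetSum _ fun _ _ => Integrable.of_finite, injVariance, mul_left_comm, ← mul_pow,
    coincidences, Finset.sum_mul]
  refine Finset.sum_congr rfl fun φ _ => ?_
  have hcharacter := integral_bitLaw_character p ρ (A := edgeImage M φ.1) (B := ∅)
    (C := edgeImage M φ.2) (D := ∅) (fun e => not_isDiag_of_mem_edgeImage) (by simp)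
    (fun e => not_isDiag_of_mem_edgeImage) (by simp)
  simp only [character, Finset.prod_empty, mul_one] at hcharacter ⊢
  rw [hcharacter]
  split_ifs with h
  · rw [h, prod_moment_mult_mult (Finset.disjoint_empty_right _), card_edgeImage,
      Finset.card_empty, add_zero, one_mul]
  · rw [zero_mul]
    refine prod_moment_eq_zero fun hcover => h ?_
    rw [isDoubleCover_iff] at hcover
    exact (by simpa using hcover.1 : edgeImage M φ.1 ⊆ _).antisymm (by simpa using hcover.2.2.1)

lemma injCount_mul_mul_eq_sum (p : I) (M N : Motif) (G H : SimpleGraph (Fin n)) :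
    injCount M (centered p G) * injCount N (centered p G)
        * (injCount M (centered p H) * injCount N (centered p H))
      = ∑ x : Quad (Fin n) M N, character p (edgeImage M x.1.1) G
          * character p (edgeImage N x.2.1) G
          * (character p (edgeImage M x.1.2) H * character p (edgeImage N x.2.2) H) := by
  rw [mul_mul_mul_comm]
  simp only [injCount_centered, Finset.sum_mul_sum, ← Fintype.sum_prod_type']
  exact Finset.sum_congr rfl fun _ _ => mul_mul_mul_comm ..

lemma mixedMoment_le (hn : 0 < n) {r : ℝ} (hr : 1 ≤ r) (hM : M.graph.Connected)
    (hN : N.graph.Connected) (heM : 1 ≤ M.e) (heN : 1 ≤ N.e)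
    (hdense : ∀ φ : Fin M.v ↪ Fin n, IsDense (r ^ 2) n (bernoulliVar p) (edgeImage M φ)) :
    mixedMoment n p ρ M N
      ≤ (ρ * bernoulliVar p) ^ (M.e + N.e)
          * (coincidences (Fin n) M M * coincidences (Fin n) N N)
        + bernoulliVar p ^ (M.e + N.e) * (2 * coincidences (Fin n) M N ^ 2)
        + bernoulliVar p ^ (M.e + N.e) * n ^ (M.v + N.v) / r * (2 * (M.v + N.v)).factorial := by
  have hn' : (0 : ℝ) < n := Nat.cast_pos.2 hn
  have : Nonempty (Fin n) := ⟨0, hn⟩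
  have hs := bernoulliVar_nonneg p
  simp only [mixedMoment, injCount_mul_mul_eq_sum]
  rw [integral_finsetSum _ fun _ _ => Integrable.of_finite]
  simp only [integral_bitLaw_character p ρ (fun _ => not_isDiag_of_mem_edgeImage)
    (fun _ => not_isDiag_of_mem_edgeImage) (fun _ => not_isDiag_of_mem_edgeImage)
    (fun _ => not_isDiag_of_mem_edgeImage)]
  refine (Finset.sum_le_sum fun x _ =>
    prod_moment_quad_le hM hN heM heN hdense hr hn' x).trans ?_
  rw [Finset.sum_add_distrib, Finset.sum_add_distrib, ← Finset.mul_sum, ← Finset.mul_sum,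
    ← Finset.mul_sum, Finset.sum_add_distrib, sum_quad_same, sum_quad_parallel, sum_quad_crossed,
    ← two_mul]
  gcongr
  simpa only [Fintype.card_fin] using
    sum_inv_pow_card_verts_edges_le (V := Fin n) hM hN heM heN

end Integrals

section Statistic

variable {n : ℕ} {p ρ : I} {F : Finset Motif} {M N : Motif}

lemma weight_mul_injVariance (h : 0 < injVariance n p M) :
    weight n p ρ M * injVariance n p M = ρ ^ M.e :=
  div_mul_cancel₀ _ h.ne'

lemma pow_mul_pow_le_injVariance (p : I) (hn : 2 * M.v ≤ n) :
    (n : ℝ) ^ M.v * bernoulliVar p ^ M.e ≤ 2 ^ M.v * injVariance n p M := by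
  have hhalf : (n : ℝ) ≤ 2 * (n + 1 - M.v : ℕ) := by exact_mod_cast (by omega)
  have hcopies : ((n + 1 - M.v : ℕ) : ℝ) ^ M.v ≤ coincidences (Fin n) M M := by
    have h := descFactorial_le_coincidences (Fin n) M
    rw [Fintype.card_fin] at h
    exact le_trans (by exact_mod_cast Nat.pow_sub_le_descFactorial n M.v) h
  calc (n : ℝ) ^ M.v * bernoulliVar p ^ M.e
      ≤ (2 * (n + 1 - M.v : ℕ)) ^ M.v * bernoulliVar p ^ M.e := by
        gcongr; exact pow_nonneg (bernoulliVar_nonneg p) _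
    _ = 2 ^ M.v * (((n + 1 - M.v : ℕ) : ℝ) ^ M.v * bernoulliVar p ^ M.e) := by
        rw [mul_pow, mul_assoc]
    _ ≤ 2 ^ M.v * injVariance n p M := by
        unfold injVariance; gcongr; exact pow_nonneg (bernoulliVar_nonneg p) _

lemma injVariance_pos (hp : 0 < bernoulliVar p) (hn : 0 < n) (hM : 2 * M.v ≤ n) :
    0 < injVariance n p M :=
  pos_of_mul_pos_right (lt_of_lt_of_le (by positivity) (pow_mul_pow_le_injVariance p hM))
    (by positivity)

lemma statistic_sq (p : I) (F : Finset Motif) (ω : Motif → ℝ)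
    (G : SimpleGraph (Fin n) × SimpleGraph (Fin n)) :
    statistic p F ω G ^ 2 = ∑ M ∈ F, ∑ N ∈ F, ω M * ω N *
      (injCount M (centered p G.1) * injCount N (centered p G.1)
        * (injCount M (centered p G.2) * injCount N (centered p G.2))) := by
  rw [statistic, sq, Finset.sum_mul_sum]
  exact Finset.sum_congr rfl fun M _ => Finset.sum_congr rfl fun N _ => by ring

lemma integral_statistic_sq_nullLaw (hF : IsMotifFamily F) (hconn : ∀ M ∈ F, M.graph.Connected)
    (he : ∀ M ∈ F, 1 ≤ M.e) (hpos : ∀ M ∈ F, 0 < injVariance n p M) :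
    ∫ G, statistic p F (weight n p ρ) G ^ 2 ∂nullLaw n p = ∑ M ∈ F, (ρ : ℝ) ^ (2 * M.e) := by
  simp only [statistic_sq, nullLaw]
  rw [integral_finsetSum _ fun _ _ => Integrable.of_finite]
  refine Finset.sum_congr rfl fun M hM => ?_
  rw [integral_finsetSum _ fun _ _ => Integrable.of_finite]
  have hterm (N : Motif) : ∫ G : SimpleGraph (Fin n) × SimpleGraph (Fin n),
      weight n p ρ M * weight n p ρ N *
      (injCount M (centered p G.1) * injCount N (centered p G.1)
        * (injCount M (centered p G.2) * injCount N (centered p G.2)))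
      ∂(SimpleGraph.binomialRandom (Fin n) p).prod (SimpleGraph.binomialRandom (Fin n) p)
      = weight n p ρ M * weight n p ρ N
        * (coincidences (Fin n) M N * bernoulliVar p ^ M.e) ^ 2 := by
    rw [integral_const_mul, integral_prod_mul
      (fun G : SimpleGraph (Fin n) => injCount M (centered p G) * injCount N (centered p G))
      (fun G : SimpleGraph (Fin n) => injCount M (centered p G) * injCount N (centered p G)),
      integral_injCount_mul, sq]
  simp only [hterm]
  rw [Finset.sum_eq_single_of_mem M hM fun N hN hne => by
    rw [coincidences_eq_zero hF hconn he hM hN hne.symm, zero_mul, zero_pow two_ne_zero, mul_zero],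
    ← injVariance, ← sq, ← mul_pow, weight_mul_injVariance (hpos M hM), ← pow_mul, mul_comm]

lemma integral_statistic_bitLaw (hpos : ∀ M ∈ F, 0 < injVariance n p M) :
    ∫ x, statistic p F (weight n p ρ) (graphPair 1 x) ∂bitLaw n p ρ
      = ∑ M ∈ F, (ρ : ℝ) ^ (2 * M.e) := by
  simp only [statistic, mul_assoc]
  rw [integral_finsetSum _ fun _ _ => Integrable.of_finite]
  refine Finset.sum_congr rfl fun M hM => ?_
  rw [integral_const_mul, integral_injCount_mul_graphPair, mul_left_comm,
    weight_mul_injVariance (hpos M hM), ← pow_add, two_mul]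

lemma mixedMoment_le_of_factorial_le (hn : 0 < n) {r η : ℝ} (hr : 1 ≤ r)
    (hM : M.graph.Connected) (hN : N.graph.Connected) (heM : 1 ≤ M.e) (heN : 1 ≤ N.e)
    (hMn : 2 * M.v ≤ n) (hNn : 2 * N.v ≤ n)
    (hdense : ∀ φ : Fin M.v ↪ Fin n, IsDense (r ^ 2) n (bernoulliVar p) (edgeImage M φ))
    (hη : 2 ^ (M.v + N.v) * (2 * (M.v + N.v)).factorial ≤ η * ρ ^ (M.e + N.e) * r) :
    mixedMoment n p ρ M N
      ≤ (1 + η) * (ρ ^ M.e * injVariance n p M) * (ρ ^ N.e * injVariance n p N)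
        + 2 * (coincidences (Fin n) M N ^ 2 * bernoulliVar p ^ (M.e + N.e)) := by
  have hM₀ := injVariance_nonneg n p M
  have hN₀ := injVariance_nonneg n p N
  have hs := bernoulliVar_nonneg p
  have hoverlap : bernoulliVar p ^ (M.e + N.e) * n ^ (M.v + N.v) / r * (2 * (M.v + N.v)).factorial
      ≤ η * (ρ ^ M.e * injVariance n p M) * (ρ ^ N.e * injVariance n p N) :=
    calc bernoulliVar p ^ (M.e + N.e) * n ^ (M.v + N.v) / r * (2 * (M.v + N.v)).factorial
        = (n ^ M.v * bernoulliVar p ^ M.e) * (n ^ N.v * bernoulliVar p ^ N.e)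
          * (2 * (M.v + N.v)).factorial / r := by rw [pow_add, pow_add]; ring
      _ ≤ (2 ^ M.v * injVariance n p M) * (2 ^ N.v * injVariance n p N)
          * (2 * (M.v + N.v)).factorial / r := by
        gcongr ?_ * ?_ * _ / _
        exacts [pow_mul_pow_le_injVariance p hMn, pow_mul_pow_le_injVariance p hNn]
      _ = injVariance n p M * injVariance n p N
          * (2 ^ (M.v + N.v) * (2 * (M.v + N.v)).factorial) / r := by rw [pow_add]; ring
      _ ≤ injVariance n p M * injVariance n p N * (η * ρ ^ (M.e + N.e) * r) / r := by gcongr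
      _ = η * (ρ ^ M.e * injVariance n p M) * (ρ ^ N.e * injVariance n p N) := by
        rw [← mul_assoc, mul_div_cancel_right₀ _ (by positivity), pow_add]; ring
  refine (mixedMoment_le hn hr hM hN heM heN hdense).trans
    ((add_le_add_right hoverlap _).trans_eq ?_)
  unfold injVariance
  ring

lemma integral_statistic_sq_bitLaw_le (hF : IsMotifFamily F)
    (hconn : ∀ M ∈ F, M.graph.Connected) (he : ∀ M ∈ F, 1 ≤ M.e)
    (hpos : ∀ M ∈ F, 0 < injVariance n p M) {η : ℝ}
    (hmixed : ∀ M ∈ F, ∀ N ∈ F,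
      mixedMoment n p ρ M N
      ≤ (1 + η) * (ρ ^ M.e * injVariance n p M) * (ρ ^ N.e * injVariance n p N)
        + 2 * (coincidences (Fin n) M N ^ 2 * bernoulliVar p ^ (M.e + N.e))) :
    ∫ x, statistic p F (weight n p ρ) (graphPair 1 x) ^ 2 ∂bitLaw n p ρ
      ≤ (1 + η) * (∑ M ∈ F, (ρ : ℝ) ^ (2 * M.e)) ^ 2 + 2 * ∑ M ∈ F, (ρ : ℝ) ^ (2 * M.e) := by
  simp only [statistic_sq]
  rw [integral_finsetSum _ fun _ _ => Integrable.of_finite, sq, Finset.sum_mul_sum,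
    Finset.mul_sum, Finset.mul_sum, ← Finset.sum_add_distrib]
  refine Finset.sum_le_sum fun M hM => ?_
  rw [integral_finsetSum _ fun _ _ => Integrable.of_finite]
  have hwM := weight_mul_injVariance (ρ := ρ) (hpos M hM)
  have hdiag : 2 * (ρ : ℝ) ^ (2 * M.e) = ∑ N ∈ F, 2 * (weight n p ρ M * weight n p ρ N
      * (coincidences (Fin n) M N ^ 2 * bernoulliVar p ^ (M.e + N.e))) := by
    rw [Finset.sum_eq_single_of_mem M hM fun N hN hne => by
      rw [coincidences_eq_zero hF hconn he hM hN hne.symm]; ring, mul_comm 2 M.e, pow_mul, ← hwM,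
      injVariance]
    ring
  rw [hdiag, Finset.mul_sum, ← Finset.sum_add_distrib]
  refine Finset.sum_le_sum fun N hN => ?_
  have hwN := weight_mul_injVariance (ρ := ρ) (hpos N hN)
  rw [integral_const_mul, ← mixedMoment]
  refine (mul_le_mul_of_nonneg_left (hmixed M hM N hN)
    (mul_nonneg (weight_nonneg n p ρ M) (weight_nonneg n p ρ N))).trans_eq ?_
  linear_combination (1 + η) * ρ ^ M.e * ρ ^ N.e
    * (weight n p ρ N * injVariance n p N * hwM + ρ ^ M.e * hwN)

end Statistic

section Asymptotics

lemma eventually_floor_mul_le {α : Type*} {l : Filter α} {C L R : α → ℝ}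
    (hC : C =o[l] fun x => L x / R x) (hL : ∀ᶠ x in l, 0 ≤ L x) (hR : ∀ᶠ x in l, 0 < R x)
    {c : ℝ} (hc : 0 < c) : ∀ᶠ x in l, ⌊C x⌋₊ * R x ≤ c * L x := by
  filter_upwards [hC.bound hc, hL, hR] with x hCx hLx hRx
  rw [← le_div_iff₀ hRx, mul_div_assoc]
  calc (⌊C x⌋₊ : ℝ) ≤ ⌊|C x|⌋₊ := by gcongr; exact le_abs_self _
    _ ≤ |C x| := Nat.floor_le (abs_nonneg _)
    _ ≤ c * (L x / R x) := by
      rwa [Real.norm_eq_abs, Real.norm_eq_abs, abs_of_nonneg (div_nonneg hLx hRx.le)] at hCx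

lemma pow_le_rpow_of_le_exp {a x y c : ℝ} {k : ℕ} (ha : 0 ≤ a) (hax : a ≤ Real.exp x)
    (hy : 0 < y) (hk : k * x ≤ c * Real.log y) : a ^ k ≤ y ^ c :=
  calc a ^ k ≤ Real.exp x ^ k := by gcongr
    _ = Real.exp (k * x) := (Real.exp_nat_mul x k).symm
    _ ≤ Real.exp (c * Real.log y) := Real.exp_le_exp.2 hk
    _ = y ^ c := by rw [Real.rpow_def_of_pos hy, mul_comm]

lemma mul_pow_mul_inv_sq_le_exp {k L x R : ℝ} (hk : 0 ≤ k) (hkL : k ≤ L) (hL : 0 < L)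
    (hx : 0 < x) (hLR : Real.log L ≤ R) (hxR : -Real.log x ≤ R) (h4 : Real.log 4 ≤ R) :
    4 * (4 * k) ^ 4 * (x ^ 2)⁻¹ ≤ Real.exp (11 * R) := by
  have h4' : (4 : ℝ) ≤ Real.exp R := (Real.log_le_iff_le_exp (by norm_num)).1 h4
  have hk' : k ≤ Real.exp R := hkL.trans <| (Real.log_le_iff_le_exp hL).1 hLR
  have hx' : x⁻¹ ≤ Real.exp R := by
    rwa [← Real.log_inv, Real.log_le_iff_le_exp (inv_pos.2 hx)] at hxR
  calc 4 * (4 * k) ^ 4 * (x ^ 2)⁻¹ = 4 * (4 * k) ^ 4 * x⁻¹ ^ 2 := by rw [inv_pow]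
    _ ≤ Real.exp R * (Real.exp R * Real.exp R) ^ 4 * Real.exp R ^ 2 := by gcongr
    _ = Real.exp R ^ 11 := by ring
    _ = Real.exp (11 * R) := by rw [← Real.exp_nat_mul]; norm_num

lemma tendsto_log_natCast_atTop : Tendsto (fun n : ℕ => Real.log n) atTop atTop :=
  Real.tendsto_log_atTop.comp tendsto_natCast_atTop_atTop

lemma tendsto_log_log_natCast_atTop :
    Tendsto (fun n : ℕ => Real.log (Real.log n)) atTop atTop :=
  Real.tendsto_log_atTop.comp tendsto_log_natCast_atTop

variable {ρ : ℕ → I} {C : ℕ → ℝ}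

lemma eventually_floor_mul_max_le (hC : C =o[atTop] (fun n : ℕ =>
      Real.log n / max (Real.log (Real.log n)) (-Real.log (ρ n)))) {c : ℝ} (hc : 0 < c) :
    ∀ᶠ n : ℕ in atTop,
      ⌊C n⌋₊ * max (Real.log (Real.log n)) (-Real.log (ρ n)) ≤ c * Real.log n :=
  eventually_floor_mul_le hC (tendsto_log_natCast_atTop.eventually_ge_atTop 0)
    ((tendsto_log_log_natCast_atTop.eventually_gt_atTop 0).mono fun _ hn =>
      hn.trans_le (le_max_left _ _)) hc

lemma eventually_floor_le_log (hC : C =o[atTop] (fun n : ℕ =>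
      Real.log n / max (Real.log (Real.log n)) (-Real.log (ρ n)))) {c : ℝ} (hc : 0 < c) :
    ∀ᶠ n : ℕ in atTop, ⌊C n⌋₊ ≤ c * Real.log n := by
  filter_upwards [eventually_floor_mul_max_le hC hc,
    tendsto_log_log_natCast_atTop.eventually_ge_atTop 1] with n hn hloglog
  exact (le_mul_of_one_le_right (Nat.cast_nonneg _) (hloglog.trans (le_max_left _ _))).trans hn

lemma eventually_two_mul_floor_le (hC : C =o[atTop] (fun n : ℕ =>
      Real.log n / max (Real.log (Real.log n)) (-Real.log (ρ n)))) :
    ∀ᶠ n : ℕ in atTop, 2 * ⌊C n⌋₊ ≤ n := by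
  filter_upwards [eventually_floor_le_log hC one_half_pos] with n hn
  have hlog : Real.log n ≤ n := Real.log_le_self n.cast_nonneg
  exact_mod_cast (by linarith : (2 * ⌊C n⌋₊ : ℝ) ≤ n)

lemma eventually_rpow_half_le_rpow_mul_pow (hC : C =o[atTop] (fun n : ℕ =>
      Real.log n / max (Real.log (Real.log n)) (-Real.log (ρ n))))
    {ε δ : ℝ} (hε : 0 < ε) (hδ : 0 < δ) :
    ∀ᶠ n : ℕ in atTop, (n : ℝ) ^ (ε / 2) ≤ (n : ℝ) ^ ε * δ ^ ⌊C n⌋₊ := by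
  filter_upwards [eventually_floor_mul_max_le hC (half_pos hε), eventually_gt_atTop 0,
    tendsto_log_log_natCast_atTop.eventually_ge_atTop (-Real.log δ)] with n hK hn hδn
  have hn₀ : (0 : ℝ) < n := Nat.cast_pos.2 hn
  have hδexp : δ⁻¹ ≤ Real.exp (max (Real.log (Real.log n)) (-Real.log (ρ n))) := by
    rw [← Real.log_le_iff_le_exp (inv_pos.2 hδ), Real.log_inv]
    exact hδn.trans (le_max_left _ _)
  have hδK := pow_le_rpow_of_le_exp (inv_nonneg.2 hδ.le) hδexp hn₀ hK
  rw [inv_pow, inv_le_iff_one_le_mul₀ (by positivity)] at hδK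
  calc (n : ℝ) ^ (ε / 2) ≤ (n : ℝ) ^ (ε / 2) * ((n : ℝ) ^ (ε / 2) * δ ^ ⌊C n⌋₊) :=
        le_mul_of_one_le_right (by positivity) hδK
    _ = (n : ℝ) ^ ε * δ ^ ⌊C n⌋₊ := by rw [← mul_assoc, ← Real.rpow_add hn₀, add_halves]

lemma eventually_pow_mul_pow_le (hρ : ∀ n, 0 < (ρ n : ℝ)) (hC : C =o[atTop] (fun n : ℕ =>
      Real.log n / max (Real.log (Real.log n)) (-Real.log (ρ n))))
    {ε η : ℝ} (hε : 0 < ε) (hη : 0 < η) :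
    ∀ᶠ n : ℕ in atTop, (4 : ℝ) ^ ⌊C n⌋₊ * (4 * ⌊C n⌋₊ : ℝ) ^ (4 * ⌊C n⌋₊)
      ≤ η * (ρ n : ℝ) ^ (2 * ⌊C n⌋₊) * (n : ℝ) ^ ε := by
  have hpow : Tendsto (fun n : ℕ => (n : ℝ) ^ (ε / 2)) atTop atTop :=
    (tendsto_rpow_atTop (half_pos hε)).comp tendsto_natCast_atTop_atTop
  filter_upwards [eventually_floor_mul_max_le hC (by positivity : 0 < ε / 22),
    eventually_floor_le_log hC one_pos, tendsto_log_natCast_atTop.eventually_gt_atTop 0,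
    tendsto_log_log_natCast_atTop.eventually_ge_atTop (Real.log 4),
    hpow.eventually_ge_atTop η⁻¹, eventually_gt_atTop 0] with n hKR hKlog hlog hlog₄ hpowη hn
  have hn₀ : (0 : ℝ) < n := Nat.cast_pos.2 hn
  have hρK : 0 < (ρ n : ℝ) ^ (2 * ⌊C n⌋₊) := pow_pos (hρ n) _
  rw [one_mul] at hKlog
  have hbase := pow_le_rpow_of_le_exp (k := ⌊C n⌋₊) (c := ε / 2) (by positivity)
    (mul_pow_mul_inv_sq_le_exp (Nat.cast_nonneg ⌊C n⌋₊) hKlog hlog (hρ n) (le_max_left _ _)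
      (le_max_right _ _) (hlog₄.trans (le_max_left _ _))) hn₀ (by linarith)
  rw [mul_pow, mul_pow, ← pow_mul, inv_pow, ← pow_mul, ← div_eq_mul_inv, div_le_iff₀ hρK]
    at hbase
  calc _ ≤ (n : ℝ) ^ (ε / 2) * (ρ n : ℝ) ^ (2 * ⌊C n⌋₊) := hbase
    _ ≤ (η * (n : ℝ) ^ (ε / 2)) * ((n : ℝ) ^ (ε / 2) * (ρ n : ℝ) ^ (2 * ⌊C n⌋₊)) :=
      le_mul_of_one_le_left (by positivity) (by rwa [inv_le_iff_one_le_mul₀' hη] at hpowη)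
    _ = η * (ρ n : ℝ) ^ (2 * ⌊C n⌋₊) * (n : ℝ) ^ (ε / 2 + ε / 2) := by
      rw [Real.rpow_add hn₀]; ring
    _ = η * (ρ n : ℝ) ^ (2 * ⌊C n⌋₊) * (n : ℝ) ^ ε := by rw [add_halves]

end Asymptotics

section Chebyshev

variable {Ω Ω' : Type*} [MeasurableSpace Ω] [MeasurableSpace Ω'] {μ : Measure Ω} {ν : Measure Ω'}
  {X : Ω → ℝ} {Y : Ω' → ℝ} {τ : ℝ}

lemma measureReal_ge_le_integral_sq_div [IsFiniteMeasure μ] (hX : MemLp X 2 μ) (hτ : 0 < τ) :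
    μ.real {ω | τ ≤ X ω} ≤ (∫ ω, X ω ^ 2 ∂μ) / τ ^ 2 := by
  rw [le_div_iff₀' (by positivity)]
  calc τ ^ 2 * μ.real {ω | τ ≤ X ω} ≤ τ ^ 2 * μ.real {ω | τ ^ 2 ≤ X ω ^ 2} := by
        gcongr ?_ * ?_
        exact measureReal_mono fun ω hω => pow_le_pow_left₀ hτ.le hω 2
    _ ≤ ∫ ω, X ω ^ 2 ∂μ := mul_meas_ge_le_integral_of_nonneg
        (.of_forall fun ω => sq_nonneg (X ω)) hX.integrable_sq (τ ^ 2)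

lemma measureReal_lt_le_variance_div [IsProbabilityMeasure μ] (hX : MemLp X 2 μ)
    (hτ : τ < ∫ ω, X ω ∂μ) :
    μ.real {ω | X ω < τ}
      ≤ ((∫ ω, X ω ^ 2 ∂μ) - (∫ ω, X ω ∂μ) ^ 2) / ((∫ ω, X ω ∂μ) - τ) ^ 2 := by
  have hvar := ProbabilityTheory.variance_eq_sub hX
  simp only [Pi.pow_apply] at hvar
  rw [← hvar]
  calc μ.real {ω | X ω < τ} ≤ μ.real {ω | (∫ ω, X ω ∂μ) - τ ≤ |X ω - ∫ ω, X ω ∂μ|} := by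
        refine measureReal_mono fun ω (hω : X ω < τ) => ?_
        rw [Set.mem_ofPred_eq, abs_sub_comm]
        exact (sub_le_sub_left hω.le _).trans (le_abs_self _)
    _ ≤ _ := ENNReal.toReal_le_of_le_ofReal
        (div_nonneg (ProbabilityTheory.variance_nonneg X μ) (sq_nonneg _))
        (ProbabilityTheory.meas_ge_le_variance_div_sq hX (sub_pos.2 hτ))

lemma measureReal_ge_add_measureReal_lt_le [IsFiniteMeasure μ] [IsProbabilityMeasure ν]
    (hX : MemLp X 2 μ) (hY : MemLp Y 2 ν) {S η : ℝ} (hS : 0 < S)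
    (hXS : ∫ ω, X ω ^ 2 ∂μ ≤ S) (hYS : ∫ ω, Y ω ∂ν = S)
    (hYη : ∫ ω, Y ω ^ 2 ∂ν ≤ (1 + η) * S ^ 2 + 2 * S) :
    μ.real {ω | S / 2 ≤ X ω} + ν.real {ω | Y ω < S / 2} ≤ 12 / S + 4 * η := by
  have hnull := measureReal_ge_le_integral_sq_div hX (half_pos hS)
  have halt := measureReal_lt_le_variance_div (τ := S / 2) hY (by linarith)
  rw [hYS] at halt
  calc _ ≤ S / (S / 2) ^ 2 + ((1 + η) * S ^ 2 + 2 * S - S ^ 2) / (S - S / 2) ^ 2 := by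
        refine add_le_add (hnull.trans ?_) (halt.trans ?_) <;> gcongr
    _ = 12 / S + 4 * η := by field_simp; ring

end Chebyshev

section Test

variable {n : ℕ} {p ρ : I} {F : Finset Motif} {M N : Motif}

lemma statistic_graphPair (p : I) (F : Finset Motif) (ω : Motif → ℝ) (π : Equiv.Perm (Fin n))
    (x : Sym2 (Fin n) → Bool × Bool) :
    statistic p F ω (graphPair π x) = statistic p F ω (graphPair 1 x) := by
  simp only [statistic, graphPair, injCount_map]

lemma altLaw_real_statistic_lt (p ρ : I) (F : Finset Motif) (ω : Motif → ℝ) (τ : ℝ) :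
    (altLaw n p ρ).real {G | statistic p F ω G < τ}
      = (bitLaw n p ρ).real {x | statistic p F ω (graphPair 1 x) < τ} := by
  have hgiven (π : Equiv.Perm (Fin n)) : altLawGiven p ρ π {G | statistic p F ω G < τ}
      = bitLaw n p ρ {x | statistic p F ω (graphPair 1 x) < τ} := by
    rw [altLawGiven, Measure.map_apply (measurable_of_finite _) (Set.toFinite _).measurableSet]
    exact congrArg (bitLaw n p ρ) <| Set.ext fun x => by
      simp only [Set.mem_preimage, Set.mem_ofPred_eq, statistic_graphPair p F ω π x]
  simp only [measureReal_def, altLaw, Measure.smul_apply, Measure.finsetSum_apply, hgiven]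
  rw [Finset.sum_const, Finset.card_univ, nsmul_eq_mul, smul_eq_mul, ← mul_assoc,
    ENNReal.inv_mul_cancel (Nat.cast_ne_zero.2 Fintype.card_ne_zero) (ENNReal.natCast_ne_top _),
    one_mul]

lemma nullLaw_real_ge_add_altLaw_real_lt_le (hF : IsMotifFamily F)
    (hconn : ∀ M ∈ F, M.graph.Connected)
    (he : ∀ M ∈ F, 1 ≤ M.e) (hpos : ∀ M ∈ F, 0 < injVariance n p M)
    (hsignal : 0 < ∑ M ∈ F, (ρ : ℝ) ^ (2 * M.e)) {η : ℝ}
    (hmixed : ∀ M ∈ F, ∀ N ∈ F, mixedMoment n p ρ M N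
      ≤ (1 + η) * (ρ ^ M.e * injVariance n p M) * (ρ ^ N.e * injVariance n p N)
        + 2 * (coincidences (Fin n) M N ^ 2 * bernoulliVar p ^ (M.e + N.e))) :
    (nullLaw n p).real {G | (∑ M ∈ F, (ρ : ℝ) ^ (2 * M.e)) / 2
        ≤ statistic p F (weight n p ρ) G}
      + (altLaw n p ρ).real {G | statistic p F (weight n p ρ) G
        < (∑ M ∈ F, (ρ : ℝ) ^ (2 * M.e)) / 2}
      ≤ 12 / (∑ M ∈ F, (ρ : ℝ) ^ (2 * M.e)) + 4 * η := by
  have : IsProbabilityMeasure (nullLaw n p) := by unfold nullLaw; infer_instance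
  rw [altLaw_real_statistic_lt]
  exact measureReal_ge_add_measureReal_lt_le .of_discrete .of_discrete hsignal
    (integral_statistic_sq_nullLaw hF hconn he hpos).le (integral_statistic_bitLaw hpos)
    (integral_statistic_sq_bitLaw_le hF hconn he hpos hmixed)

lemma statistic_ite (p : I) (F : Finset Motif) (P : Motif → Prop) [DecidablePred P]
    (ω : Motif → ℝ) (G : SimpleGraph (Fin n) × SimpleGraph (Fin n)) :
    statistic p F (fun M => if P M then ω M else 0) G = statistic p (F.filter P) ω G := by
  simp only [statistic, Finset.sum_filter, ite_mul, zero_mul]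

lemma nonempty_unique_of_e_eq_zero (hM : M.graph.Connected) (he : M.e = 0) :
    Nonempty (Unique (Fin M.v)) := by
  rwa [Motif.e_eq_zero_iff.1 he, SimpleGraph.connected_bot_iff,
    ← unique_iff_subsingleton_and_nonempty] at hM

lemma nonempty_iso_of_e_eq_zero (hM : M.graph.Connected) (hN : N.graph.Connected)
    (heM : M.e = 0) (heN : N.e = 0) : Nonempty (M.graph ≃g N.graph) := by
  obtain ⟨_⟩ := nonempty_unique_of_e_eq_zero hM heM
  obtain ⟨_⟩ := nonempty_unique_of_e_eq_zero hN heN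
  rw [Motif.e_eq_zero_iff.1 heM, Motif.e_eq_zero_iff.1 heN]
  exact ⟨⟨Equiv.ofUnique _ _, Iff.rfl⟩⟩

lemma sum_le_sum_filter_one_le_e_add_one (ρ : I) (hF : IsMotifFamily F)
    (hconn : ∀ M ∈ F, M.graph.Connected) :
    ∑ M ∈ F, (ρ : ℝ) ^ (2 * M.e) ≤ ∑ M ∈ F with 1 ≤ M.e, (ρ : ℝ) ^ (2 * M.e) + 1 := by
  rw [← Finset.sum_filter_add_sum_filter_not F (fun M => 1 ≤ M.e)]
  gcongr
  have hcard : (F.filter fun M => ¬ 1 ≤ M.e).card ≤ 1 := Finset.card_le_one.2 fun M hM N hN => by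
    simp only [Finset.mem_filter, not_le, Nat.lt_one_iff] at hM hN
    exact hF M hM.1 N hN.1 <|
      nonempty_iso_of_e_eq_zero (hconn M hM.1) (hconn N hN.1) hM.2 hN.2
  calc ∑ M ∈ F with ¬ 1 ≤ M.e, (ρ : ℝ) ^ (2 * M.e)
      ≤ (F.filter fun M => ¬ 1 ≤ M.e).card • (1 : ℝ) :=
        Finset.sum_le_card_nsmul _ _ _ fun M _ => pow_le_one₀ ρ.2.1 ρ.2.2
    _ ≤ 1 := by rw [nsmul_one]; exact_mod_cast hcard

lemma two_pow_mul_factorial_le {a b K : ℕ} (ha : a ≤ K) (hb : b ≤ K) :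
    2 ^ (a + b) * (2 * (a + b)).factorial ≤ 4 ^ K * (4 * K) ^ (4 * K) :=
  calc 2 ^ (a + b) * (2 * (a + b)).factorial ≤ 2 ^ (2 * K) * (4 * K).factorial :=
        Nat.mul_le_mul (Nat.pow_le_pow_right two_pos (by omega)) (Nat.factorial_le (by omega))
    _ ≤ 4 ^ K * (4 * K) ^ (4 * K) := by
        rw [pow_mul]
        exact Nat.mul_le_mul_left _ (Nat.factorial_le_pow _)

lemma IsAdmissibleAt.mixedMoment_le {C ε δ η : ℝ} (h : IsAdmissibleAt n p ρ C ε F)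
    (hδ : 0 < δ) (hp : (p : ℝ) ≤ 1 - δ) (hε : 0 ≤ ε) (hη : 0 ≤ η) (hn : 0 < n)
    (hC : 2 * ⌊C⌋₊ ≤ n) (hdense : (n : ℝ) ^ (ε / 2) ≤ (n : ℝ) ^ ε * δ ^ ⌊C⌋₊)
    (hsmall : (4 : ℝ) ^ ⌊C⌋₊ * (4 * ⌊C⌋₊ : ℝ) ^ (4 * ⌊C⌋₊)
      ≤ η * (ρ : ℝ) ^ (2 * ⌊C⌋₊) * (n : ℝ) ^ (ε / 4))
    (hM : M ∈ F) (hN : N ∈ F) (heM : 1 ≤ M.e) (heN : 1 ≤ N.e) :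
    mixedMoment n p ρ M N
      ≤ (1 + η) * (ρ ^ M.e * injVariance n p M) * (ρ ^ N.e * injVariance n p N)
        + 2 * (coincidences (Fin n) M N ^ 2 * bernoulliVar p ^ (M.e + N.e)) := by
  have hv (M) (hM : M ∈ F) : M.v ≤ ⌊C⌋₊ := Nat.le_floor (h.size_le M hM).1
  have he (M) (hM : M ∈ F) : M.e ≤ ⌊C⌋₊ := Nat.le_floor (h.size_le M hM).2
  have hn₀ : (0 : ℝ) < n := Nat.cast_pos.2 hn
  have hp₀ : 0 ≤ (p : ℝ) := p.2.1
  refine mixedMoment_le_of_factorial_le hn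
    (Real.one_le_rpow (Nat.one_le_cast.2 hn) (by positivity : 0 ≤ ε / 4))
    (h.connected M hM) (h.connected N hN) heM heN
    ((Nat.mul_le_mul_left 2 (hv M hM)).trans hC) ((Nat.mul_le_mul_left 2 (hv N hN)).trans hC)
    (fun φ => ?_) ?_
  · rw [← Real.rpow_natCast, ← Real.rpow_mul hn₀.le,
      show ε / 4 * (2 : ℕ) = ε / 2 by push_cast; ring]
    exact (isDense_edgeImage (h.connected M hM) heM (h.subgraph M hM) φ).of_mul_le hn₀.le hp₀ hδ.le
      (by linarith) ((card_edgeImage M φ).trans_le (he M hM))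
      (mul_le_mul_of_nonneg_left (by linarith) hp₀) hdense
  · calc (2 ^ (M.v + N.v) * (2 * (M.v + N.v)).factorial : ℝ)
        ≤ 4 ^ ⌊C⌋₊ * (4 * ⌊C⌋₊) ^ (4 * ⌊C⌋₊) :=
          mod_cast two_pow_mul_factorial_le (hv M hM) (hv N hN)
      _ ≤ η * ρ ^ (2 * ⌊C⌋₊) * n ^ (ε / 4) := hsmall
      _ ≤ η * ρ ^ (M.e + N.e) * n ^ (ε / 4) := by
          have heMN : M.e + N.e ≤ 2 * ⌊C⌋₊ := by linarith [he M hM, he N hN]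
          gcongr ?_ * ?_ * _
          exact pow_le_pow_of_le_one ρ.2.1 ρ.2.2 heMN

end Test

end MotifTest

theorem mainTheorem1
    (p ρ : ℕ → I) (C : ℕ → ℝ) (F : ℕ → Finset MotifTest.Motif) (δ : ℝ)
    (hp : ∀ n, 0 < (p n : ℝ)) (hδ : 0 < δ) (hp' : ∀ n, (p n : ℝ) ≤ 1 - δ)
    (hρ : ∀ n, 0 < (ρ n : ℝ))
    (hF : ∀ n, MotifTest.IsMotifFamily (F n))
    (hadm : MotifTest.IsAdmissible p ρ C F) :
    ∀ᶠ n in atTop, ∃ (ω : MotifTest.Motif → ℝ) (τ : ℝ),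
      (MotifTest.nullLaw n (p n)).real {G | τ ≤ MotifTest.statistic (p n) (F n) ω G}
        + (MotifTest.altLaw n (p n) (ρ n)).real {G | MotifTest.statistic (p n) (F n) ω G < τ}
        ≤ 0.05 := by
  obtain ⟨hC, ε, hε, hadm⟩ := hadm
  filter_upwards [hadm, eventually_gt_atTop 0, MotifTest.eventually_two_mul_floor_le hC,
    MotifTest.eventually_rpow_half_le_rpow_mul_pow hC hε hδ,
    MotifTest.eventually_pow_mul_pow_le hρ hC (by positivity : 0 < ε / 4)
      (by norm_num : (0 : ℝ) < 1 / 250)] with n hn hn₀ hsize hdense hsmall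
  refine ⟨fun M => if 1 ≤ M.e then MotifTest.weight n (p n) (ρ n) M else 0,
    (∑ M ∈ F n with 1 ≤ M.e, (ρ n : ℝ) ^ (2 * M.e)) / 2, ?_⟩
  -- A connected motif without edges is a single vertex. Its count is not random, so it gets weight
  -- `0`, and it accounts for at most `1` of the signal.
  have hsignal : 399 ≤ ∑ M ∈ F n with 1 ≤ M.e, (ρ n : ℝ) ^ (2 * M.e) := by
    linarith [hn.signal, MotifTest.sum_le_sum_filter_one_le_e_add_one (ρ n) (hF n) hn.connected]
  have hvar : 0 < MotifTest.bernoulliVar (p n) := mul_pos (hp n) (by linarith [hp' n])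
  have hv (M) (hM : M ∈ F n) : M.v ≤ ⌊C n⌋₊ := Nat.le_floor (hn.size_le M hM).1
  simp only [MotifTest.statistic_ite]
  calc _ ≤ 12 / (∑ M ∈ F n with 1 ≤ M.e, (ρ n : ℝ) ^ (2 * M.e)) + 4 * (1 / 250) := by
        refine MotifTest.nullLaw_real_ge_add_altLaw_real_lt_le ?_ ?_ ?_ ?_ (by linarith) ?_ <;>
          simp only [MotifTest.IsMotifFamily, Finset.mem_filter]
        · exact fun M hM N hN => hF n M hM.1 N hN.1
        · exact fun M hM => hn.connected M hM.1
        · exact fun M hM => hM.2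
        · exact fun M hM => MotifTest.injVariance_pos hvar hn₀ (by have := hv M hM.1; omega)
        · exact fun M hM N hN => hn.mixedMoment_le hδ (hp' n) hε.le (by norm_num) hn₀ hsize hdense
            hsmall hM.1 hN.1 hM.2 hN.2
    _ ≤ 12 / 399 + 4 * (1 / 250) := by gcongr
    _ ≤ 0.05 := by norm_num
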